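/- Let $P\subset\mathbb{R}^3$ be a $3$-dimensional polytope, that is, the convex hull of finitely many points, with nonempty interior. Call $P$ \emph{equiprojective} when there is an integer $k$ such that, for every plane $H$ that is not orthogonal to (the plane spanned by) a facet of $P$, the orthogonal projection of $P$ on $H$ is a polygon with exactly $k$ vertices. An \emph{edge direction} of $P$ is a unit vector $u\in\mathbb{S}^2$ whose first non-zero coordinate is positive and such that the difference of the two vertices of some edge of $P$ is a multiple of $u$. For a nonempty face $F$ of $P$, the \emph{normal cone} of $P$ at $F$ is $N_P(F)=\{v\in\mathbb{R}^3 : v\cdot x\le v\cdot y \text{ for all } x\in P,\ y\in F\}$. For a non-zero vector $u$, with orthogonal plane $u^\perp$, the \emph{aggregated cone} $C_P(u)$ is the union of the $2$-dimensional normal cones of $P$ that are contained in $u^\perp$. Then $P$ is equiprojective if and only if, for every edge direction $u$ of $P$, either (i) $C_P(u)=u^\perp$, or (ii) $C_P(u)$ and the relative interior of $-C_P(u)$ (its interior relative to its affine hull) form a partition of $u^\perp$, that is, they are disjoint and their union is $u^\perp$. -/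

import Mathlib

open scoped Pointwise

noncomputable section

/-- Three-dimensional Euclidean space. -/
abbrev E3 : Type := EuclideanSpace ℝ (Fin 3)

/-- The dimension of a (nonempty) subset of `ℝ³`: the dimension of its affine hull. -/
def setDim (S : Set E3) : ℕ := Module.finrank ℝ (vectorSpan ℝ S)

/-- A polytope: the convex hull of finitely many points. -/
def IsPolytope (P : Set E3) : Prop :=
  ∃ s : Set E3, s.Finite ∧ P = convexHull ℝ s

/-- A (nonempty) face of `P`: the set of points of `P` where some linear functional is maximal
on `P`. The polytope itself is a face, obtained from the zero functional. -/
def IsFace (P F : Set E3) : Prop :=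
  F.Nonempty ∧ IsExposed ℝ P F

/-- The facets of a 3-dimensional polytope: its 2-dimensional faces. -/
def IsFacet (P F : Set E3) : Prop :=
  IsFace P F ∧ setDim F = 2

/-- `P` has an edge (a 1-dimensional face) whose vertices are the two distinct points `a`, `b`. -/
def IsEdge (P : Set E3) (a b : E3) : Prop :=
  a ≠ b ∧ IsFace P (segment ℝ a b)

/-- `Q` is a polygon (2-dimensional polytope) with exactly `k` vertices. -/
def IsPolygonWith (k : ℕ) (Q : Set E3) : Prop :=
  IsPolytope Q ∧ setDim Q = 2 ∧ (Q.extremePoints ℝ).ncard = k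

/-- The plane `H` is orthogonal to (the plane spanned by) the 2-dimensional set `F`, as planes of
`ℝ³`: the normal line of `H` is parallel to the plane spanned by `F`. -/
def PlaneOrthogonalTo (H : Submodule ℝ E3) (F : Set E3) : Prop :=
  Hᗮ ≤ vectorSpan ℝ F

/-- `P` is `k`-equiprojective: its orthogonal projection on any plane that is not orthogonal to a
facet of `P` is a polygon with `k` vertices. Planes through the origin suffice: the projections
on two parallel planes are translates of one another. -/
def IsKEquiprojective (k : ℕ) (P : Set E3) : Prop :=
  ∀ H : Submodule ℝ E3, Module.finrank ℝ H = 2 →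
    (∀ F : Set E3, IsFacet P F → ¬ PlaneOrthogonalTo H F) →
    IsPolygonWith k (H.starProjection '' P)

/-- `P` is equiprojective: it is `k`-equiprojective for some `k`. -/
def IsEquiprojective (P : Set E3) : Prop :=
  ∃ k : ℕ, IsKEquiprojective k P

/-- The normal cone `N_P(F)`. -/
def polytopeNormalCone (P F : Set E3) : Set E3 :=
  {v | ∀ x ∈ P, ∀ y ∈ F, inner ℝ v x ≤ inner ℝ v y}

/-- The plane `u^⊥` (when `u ≠ 0`). -/
def perpPlane (u : E3) : Set E3 := {v | inner ℝ u v = 0}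

/-- The aggregated cone `C_P(u)`: the union of the 2-dimensional normal cones of `P` that are
contained in `u^⊥`. -/
def aggregatedCone (P : Set E3) (u : E3) : Set E3 :=
  ⋃₀ {N | ∃ F, IsFace P F ∧ N = polytopeNormalCone P F ∧ setDim N = 2 ∧ N ⊆ perpPlane u}

/-- `u` is an edge direction of `P`: a unit vector whose first non-zero coordinate is positive and
such that the difference of the vertices of some edge of `P` is a multiple of `u`. -/
def IsEdgeDirection (P : Set E3) (u : E3) : Prop :=
  ‖u‖ = 1 ∧ (∃ i : Fin 3, 0 < u i ∧ ∀ j < i, u j = 0) ∧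
    ∃ a b : E3, IsEdge P a b ∧ ∃ c : ℝ, b - a = c • u

end

open scoped Pointwise
open Filter Topology


/-! Project `P` along a unit vector `w` parallel to no facet. The image is a polygon, so it has as
many vertices as edges, and its edges are images of edges of `P` (faces of larger dimension are
excluded by genericity). An edge of direction `u` yields an edge of the image exactly when it is
exposed by a vector orthogonal to both `u` and `w`, that is, a multiple of `w × u`. A generic vector
of this kind exposes such an edge if and only if it lies in `C(u)`. Hence the number of vertices is
the sum over edge directions `u` of the number of vectors among `±(w × u)` in `C(u)`
(`ncard_extremePoints_projection`).

Sufficiency: each summand is constant, equal to 2 under (i) and to 1 under (ii).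

Necessity: fix `u₀` and compare the generic directions `u₀ + εm` and `u₀ - εm`. The summand of `u₀`
is the same for both, namely the count at `m × u₀`. For `u ≠ u₀`, the two vectors `(u₀ ± εm) × u`
lie on opposite sides of the line of `u₀ × u` in the plane orthogonal to `u`, so the sum of their
counts does not depend on `m` (`exists_sum_antipodalCount_eq`). Equiprojectivity therefore makes the
count of `u₀` a constant `c` on a dense subset of its orthogonal plane. Since `C(u₀)` is closed with
nonempty relative interior, `c` is 1 or 2: the value 2 gives (i) and the value 1 gives (ii). -/

/-! ### Cross products and orthogonal planes -/

/-- The cross product on `E3`. -/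
def cross3 (a b : E3) : E3 :=
  !₂[a 1 * b 2 - a 2 * b 1, a 2 * b 0 - a 0 * b 2, a 0 * b 1 - a 1 * b 0]

theorem inner_eq_coords (a b : E3) : inner ℝ a b = a 0 * b 0 + a 1 * b 1 + a 2 * b 2 := by
  simp [PiLp.inner_apply, Fin.sum_univ_three]
  ring

@[simp] theorem cross3_zero_coord (a b : E3) : cross3 a b 0 = a 1 * b 2 - a 2 * b 1 := rfl
@[simp] theorem cross3_one_coord (a b : E3) : cross3 a b 1 = a 2 * b 0 - a 0 * b 2 := rfl
@[simp] theorem cross3_two_coord (a b : E3) : cross3 a b 2 = a 0 * b 1 - a 1 * b 0 := rfl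

theorem ext_coords {a b : E3} (h0 : a 0 = b 0) (h1 : a 1 = b 1) (h2 : a 2 = b 2) : a = b := by
  ext i
  fin_cases i
  exacts [h0, h1, h2]

theorem cross3_add_left (a b c : E3) : cross3 (a + b) c = cross3 a c + cross3 b c := by
  apply ext_coords <;> simp <;> ring

theorem cross3_sub_left (a b c : E3) : cross3 (a - b) c = cross3 a c - cross3 b c := by
  apply ext_coords <;> simp <;> ring

theorem cross3_sub_right (a b c : E3) : cross3 a (b - c) = cross3 a b - cross3 a c := by
  apply ext_coords <;> simp <;> ring

theorem cross3_smul_left (r : ℝ) (a b : E3) : cross3 (r • a) b = r • cross3 a b := by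
  apply ext_coords <;> simp <;> ring

theorem cross3_smul_right (r : ℝ) (a b : E3) : cross3 a (r • b) = r • cross3 a b := by
  apply ext_coords <;> simp <;> ring

theorem cross3_anticomm (a b : E3) : cross3 a b = -cross3 b a := by
  apply ext_coords <;> simp <;> ring

theorem cross3_self (a : E3) : cross3 a a = 0 := by
  apply ext_coords <;> simp <;> ring

theorem inner_self_cross3 (a b : E3) : inner ℝ a (cross3 a b) = 0 := by
  simp [inner_eq_coords]; ring

theorem inner_cross3_self (a b : E3) : inner ℝ b (cross3 a b) = 0 := by
  simp [inner_eq_coords]; ring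

theorem inner_cross3_comm (a b c : E3) : inner ℝ (cross3 a b) c = inner ℝ a (cross3 b c) := by
  simp [inner_eq_coords]; ring

theorem inner_cross3_swap (a b c : E3) : inner ℝ a (cross3 b c) = - inner ℝ c (cross3 b a) := by
  simp [inner_eq_coords]; ring

theorem cross3_cross3 (a b c : E3) : cross3 a (cross3 b c) = inner ℝ a c • b - inner ℝ a b • c := by
  apply ext_coords <;> simp [inner_eq_coords] <;> ring

theorem inner_cross3_cross3 (w a b : E3) (hw : ‖w‖ = 1) (ha : inner ℝ w a = 0) :
    inner ℝ (cross3 w a) (cross3 w b) = inner ℝ a b := by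
  have h : inner ℝ w w = (1 : ℝ) := by rw [real_inner_self_eq_norm_sq, hw, one_pow]
  rw [inner_cross3_comm, cross3_cross3, inner_sub_right, real_inner_smul_right, real_inner_smul_right,
    h, real_inner_comm w a, ha]
  ring

theorem exists_smul_of_cross3_eq_zero {a b : E3} (ha : a ≠ 0) (h : cross3 a b = 0) :
    ∃ c : ℝ, b = c • a := by
  have h1 := cross3_cross3 a a b
  have h2 : inner ℝ a a ≠ (0 : ℝ) := inner_self_ne_zero.mpr ha
  refine ⟨inner ℝ a b / inner ℝ a a, ?_⟩
  have h3 : cross3 a (cross3 a b) = 0 := by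
    rw [h]; apply ext_coords <;> simp
  rw [h3] at h1
  have h4 : inner ℝ a b • a = inner ℝ a a • b := (sub_eq_zero.mp h1.symm)
  rw [div_eq_inv_mul, mul_smul, h4, smul_smul, inv_mul_cancel₀ h2, one_smul]

/-- Two vectors orthogonal to `u ≠ 0`: the second is a combination of the first and its image under
the rotation by a right angle. -/
theorem smul_eq_of_orthogonal {u a b : E3} (ha : inner ℝ u a = 0) (hb : inner ℝ u b = 0) :
    (inner ℝ u u * inner ℝ a a) • b =
      (inner ℝ u u * inner ℝ a b) • a + inner ℝ (cross3 u a) b • cross3 u a := by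
  -- Both sides are `b × (a × (u × a))`, because `a × (u × a) = |a|² u`. Applying `u ×` to this
  -- identity gives the claim.
  have h1 : inner ℝ a a • cross3 b u =
      inner ℝ b (cross3 u a) • a - inner ℝ b a • cross3 u a := by
    rw [← cross3_cross3, cross3_cross3 a u a, real_inner_comm u a, ha, zero_smul, sub_zero,
      cross3_smul_right]
  have h2 : cross3 u (cross3 b u) = inner ℝ u u • b := by
    rw [cross3_cross3, hb, zero_smul, sub_zero]
  have h3 : cross3 u (cross3 u a) = -(inner ℝ u u • a) := by
    rw [cross3_cross3, ha, zero_smul, zero_sub]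
  have h4 := congrArg (cross3 u) h1
  rw [cross3_smul_right, h2, cross3_sub_right, cross3_smul_right, cross3_smul_right, h3] at h4
  rw [mul_comm, mul_smul, h4, real_inner_comm b a, real_inner_comm b]
  module

theorem mem_perpPlane {u v : E3} : v ∈ perpPlane u ↔ inner ℝ u v = 0 := Iff.rfl

theorem coe_orthogonal_span (u : E3) : (((ℝ ∙ u)ᗮ : Submodule ℝ E3) : Set E3) = perpPlane u := by
  ext v
  simp [Submodule.mem_orthogonal_singleton_iff_inner_right, perpPlane]

theorem finrank_orthogonal_span {u : E3} (hu : u ≠ 0) :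
    Module.finrank ℝ ((ℝ ∙ u)ᗮ : Submodule ℝ E3) = 2 := by
  have : Fact (Module.finrank ℝ E3 = 2 + 1) := ⟨by simp⟩
  exact Submodule.finrank_orthogonal_span_singleton hu

/-! ### Exposed faces and normal cones -/

/-- The points of `P` where the linear functional `⟪v, ·⟫` is maximal. -/
def supportFace (P : Set E3) (v : E3) : Set E3 :=
  {x | x ∈ P ∧ ∀ y ∈ P, inner ℝ v y ≤ inner ℝ v x}

theorem IsFace.exists_supportFace {P F : Set E3} (h : IsFace P F) : ∃ v, F = supportFace P v := by
  obtain ⟨l, hl⟩ := h.2 h.1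
  refine ⟨(InnerProductSpace.toDual ℝ E3).symm l, ?_⟩
  rw [hl]
  ext x
  simp [supportFace]

theorem supportFace_isExposed (P : Set E3) (v : E3) : IsExposed ℝ P (supportFace P v) := by
  intro _
  exact ⟨innerSL ℝ v, by ext x; simp [supportFace]⟩

theorem supportFace_nonempty {P : Set E3} (hc : IsCompact P) (hne : P.Nonempty) (v : E3) :
    (supportFace P v).Nonempty := by
  obtain ⟨x, hx, h⟩ := hc.exists_isMaxOn hne (f := fun y => inner ℝ v y) (by fun_prop)
  exact ⟨x, hx, fun y hy => h hy⟩

theorem isFace_supportFace {P : Set E3} (hc : IsCompact P) (hne : P.Nonempty) (v : E3) :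
    IsFace P (supportFace P v) :=
  ⟨supportFace_nonempty hc hne v, supportFace_isExposed P v⟩

theorem inner_eq_of_mem_supportFace {P : Set E3} {v x y : E3} (hx : x ∈ supportFace P v)
    (hy : y ∈ supportFace P v) : inner ℝ v x = inner ℝ v y :=
  le_antisymm (hy.2 x hx.1) (hx.2 y hy.1)

theorem mem_supportFace_of_inner_eq {P : Set E3} {v x y : E3} (hx : x ∈ supportFace P v)
    (hy : y ∈ P) (h : inner ℝ v x = inner ℝ v y) : y ∈ supportFace P v :=
  ⟨hy, fun z hz => h ▸ hx.2 z hz⟩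

theorem vectorSpan_supportFace_le (P : Set E3) (v : E3) :
    vectorSpan ℝ (supportFace P v) ≤ (ℝ ∙ v)ᗮ := by
  rw [vectorSpan_def, Submodule.span_le]
  rintro _ ⟨x, hx, y, hy, rfl⟩
  simp only [SetLike.mem_coe, Submodule.mem_orthogonal_singleton_iff_inner_right, vsub_eq_sub,
    inner_sub_right, inner_eq_of_mem_supportFace hx hy, sub_self]

theorem sub_mem_vectorSpan {S : Set E3} {x y : E3} (hx : x ∈ S) (hy : y ∈ S) :
    x - y ∈ vectorSpan ℝ S :=
  vsub_mem_vectorSpan ℝ hx hy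

theorem mem_polytopeNormalCone_supportFace {P : Set E3} {v v' : E3} :
    v' ∈ polytopeNormalCone P (supportFace P v) ↔ supportFace P v ⊆ supportFace P v' :=
  ⟨fun h y hy => ⟨hy.1, fun x hx => h x hx y hy⟩, fun h x hx _ hy => (h hy).2 x hx⟩

theorem self_mem_polytopeNormalCone (P : Set E3) (v : E3) :
    v ∈ polytopeNormalCone P (supportFace P v) :=
  mem_polytopeNormalCone_supportFace.2 subset_rfl

theorem isClosed_polytopeNormalCone (P F : Set E3) : IsClosed (polytopeNormalCone P F) := by
  have : polytopeNormalCone P F =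
      ⋂ x ∈ P, ⋂ y ∈ F, {v : E3 | inner ℝ v x ≤ inner ℝ v y} := by
    ext v; simp [polytopeNormalCone]
  rw [this]
  refine isClosed_biInter fun x _ => isClosed_biInter fun y _ => ?_
  exact isClosed_le (by fun_prop) (by fun_prop)

theorem convex_polytopeNormalCone (P F : Set E3) : Convex ℝ (polytopeNormalCone P F) := by
  intro v hv v' hv' a b ha hb _ x hx y hy
  simp only [inner_add_left, real_inner_smul_left]
  have := hv x hx y hy
  have := hv' x hx y hy
  gcongr

theorem smul_mem_polytopeNormalCone {P F : Set E3} {v : E3} {c : ℝ} (hc : 0 ≤ c)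
    (hv : v ∈ polytopeNormalCone P F) : c • v ∈ polytopeNormalCone P F := by
  intro x hx y hy
  simp only [real_inner_smul_left]
  have := hv x hx y hy
  gcongr

theorem polytopeNormalCone_subset_perpPlane_sub {P F : Set E3} (hF : F ⊆ P) {x y : E3} (hx : x ∈ F)
    (hy : y ∈ F) : polytopeNormalCone P F ⊆ perpPlane (x - y) := by
  intro v hv
  have h1 := hv x (hF hx) y hy
  have h2 := hv y (hF hy) x hx
  rw [mem_perpPlane, real_inner_comm, inner_sub_right]
  linarith

/-- Near `v`, the vectors orthogonal to the face exposed by `v` are in the normal cone of that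
face. -/
theorem IsPolytope.eventually_mem_polytopeNormalCone {P : Set E3} (hP : IsPolytope P) (v : E3) :
    ∀ᶠ v' in nhds v, (∀ x ∈ vectorSpan ℝ (supportFace P v), inner ℝ v' x = 0) →
      v' ∈ polytopeNormalCone P (supportFace P v) := by
  obtain ⟨s, hs, rfl⟩ := hP
  rcases s.eq_empty_or_nonempty with rfl | hne
  · filter_upwards with v' _ x hx
    simp at hx
  obtain ⟨x₀, hx₀⟩ := supportFace_nonempty (hs.isCompact_convexHull ℝ)
    (hne.convexHull (𝕜 := ℝ)) v
  -- At a generator outside the face the inequality is strict, so it survives a small perturbation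
  -- of `v`; there are finitely many generators.
  have h1 : ∀ p ∈ s, ∀ᶠ v' in nhds v, p ∉ supportFace (convexHull ℝ s) v →
      inner ℝ v' p < inner ℝ v' x₀ := by
    intro p hp
    by_cases h : p ∈ supportFace (convexHull ℝ s) v
    · filter_upwards with v' h' using absurd h h'
    · have h2 : inner ℝ v p < inner ℝ v x₀ := by
        refine lt_of_le_of_ne (hx₀.2 p (subset_convexHull ℝ s hp)) fun h3 => h ?_
        exact mem_supportFace_of_inner_eq hx₀ (subset_convexHull ℝ s hp) h3.symm
      have h3 : ∀ᶠ v' in nhds v, inner ℝ v' p < inner ℝ v' x₀ :=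
        (continuous_id.inner continuous_const).continuousAt.eventually_lt
          (continuous_id.inner continuous_const).continuousAt h2
      filter_upwards [h3] with v' h4 _ using h4
  filter_upwards [(Filter.eventually_all_finite hs).2 h1] with v' hv' hort x hx y hy
  have h2 : ∀ z ∈ supportFace (convexHull ℝ s) v, inner ℝ v' z = inner ℝ v' x₀ := by
    intro z hz
    have := hort _ (sub_mem_vectorSpan hz hx₀)
    rwa [inner_sub_right, sub_eq_zero] at this
  rw [h2 y hy]
  have h3 : convexHull ℝ s ⊆ {z | inner ℝ v' z ≤ inner ℝ v' x₀} := by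
    refine convexHull_min (fun p hp => ?_) ?_
    · by_cases h : p ∈ supportFace (convexHull ℝ s) v
      · exact (h2 p h).le
      · exact (hv' p hp h).le
    · exact convex_halfSpace_le (innerₛₗ ℝ v').isLinear _
  exact h3 hx

/-- By Krein–Milman a face is determined by its extreme points, which form a subset of the finite
generating set. -/
theorem IsPolytope.finite_setOf_isFace {P : Set E3} (hP : IsPolytope P) :
    {F | IsFace P F}.Finite := by
  obtain ⟨s, hs, rfl⟩ := hP
  refine Set.Finite.of_finite_image (f := fun F => F.extremePoints ℝ) ?_ ?_
  · refine hs.finite_subsets.subset ?_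
    rintro _ ⟨F, hF, rfl⟩
    exact (hF.2.isExtreme.extremePoints_subset_extremePoints).trans extremePoints_convexHull_subset
  · intro F hF G hG h
    have hc := hs.isCompact_convexHull ℝ
    rw [← closure_convexHull_extremePoints (hF.2.isCompact hc) (hF.2.convex (convex_convexHull ℝ s)),
      ← closure_convexHull_extremePoints (hG.2.isCompact hc) (hG.2.convex (convex_convexHull ℝ s))]
    simp only at h
    rw [h]

theorem IsPolytope.isCompact {P : Set E3} (hP : IsPolytope P) : IsCompact P := by
  obtain ⟨s, hs, rfl⟩ := hP
  exact hs.isCompact_convexHull ℝ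

theorem IsPolytope.convex {P : Set E3} (hP : IsPolytope P) : Convex ℝ P := by
  obtain ⟨s, hs, rfl⟩ := hP
  exact convex_convexHull ℝ s

/-! ### Edge normals and the aggregated cone -/

/-- The vectors exposing a face of `P` that spans the line of direction `u`. -/
def edgeNormals (P : Set E3) (u : E3) : Set E3 :=
  {v | vectorSpan ℝ (supportFace P v) = ℝ ∙ u}

theorem vectorSpan_eq_top {P : Set E3} (hdim : setDim P = 3) : vectorSpan ℝ P = ⊤ :=
  Submodule.eq_top_of_finrank_eq (by
    rw [show Module.finrank ℝ (vectorSpan ℝ P) = 3 from hdim]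
    simp)

theorem nonempty_of_setDim {P : Set E3} (hdim : setDim P = 3) : P.Nonempty := by
  rcases P.eq_empty_or_nonempty with rfl | h
  · rw [setDim, vectorSpan_empty, finrank_bot] at hdim
    omega
  · exact h

theorem vectorSpan_of_subset_perpPlane {N : Set E3} {u : E3} (hu : u ≠ 0) (hN : setDim N = 2)
    (hsub : N ⊆ perpPlane u) : vectorSpan ℝ N = (ℝ ∙ u)ᗮ := by
  refine Submodule.eq_of_le_of_finrank_eq ?_ ?_
  · rw [vectorSpan_def, Submodule.span_le]
    rintro _ ⟨x, hx, y, hy, rfl⟩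
    rw [← coe_orthogonal_span] at hsub
    exact Submodule.sub_mem _ (hsub hx) (hsub hy)
  · rw [finrank_orthogonal_span hu]
    exact hN

/-- A subset that contains the points of a subspace near one of its points spans that subspace. -/
theorem le_vectorSpan_of_eventually {N : Set E3} {W : Submodule ℝ E3} {v : E3} (hv : v ∈ W)
    (h : ∀ᶠ v' in nhds v, v' ∈ W → v' ∈ N) : W ≤ vectorSpan ℝ N := by
  intro d hd
  have ht : Filter.Tendsto (fun t : ℝ => v + t • d) (nhds 0) (nhds v) := by
    have : Continuous (fun t : ℝ => v + t • d) := by fun_prop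
    simpa using this.tendsto 0
  have h1 : ∀ᶠ t in nhdsWithin (0 : ℝ) {0}ᶜ, v + t • d ∈ W → v + t • d ∈ N :=
    (ht.eventually h).filter_mono nhdsWithin_le_nhds
  obtain ⟨t, ht1, ht2⟩ := (h1.and self_mem_nhdsWithin).exists
  have h2 := sub_mem_vectorSpan (ht1 (W.add_mem hv (W.smul_mem t hd))) (h.self_of_nhds hv)
  rw [add_sub_cancel_left] at h2
  have h3 := (vectorSpan ℝ N).smul_mem t⁻¹ h2
  rwa [smul_smul, inv_mul_cancel₀ ht2, one_smul] at h3

theorem inner_eq_zero_of_mem_edgeNormals {P : Set E3} {u v : E3} (hv : v ∈ edgeNormals P u) :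
    inner ℝ u v = 0 := by
  have h : u ∈ vectorSpan ℝ (supportFace P v) := by
    rw [show vectorSpan ℝ (supportFace P v) = ℝ ∙ u from hv]
    exact Submodule.mem_span_singleton_self u
  have := vectorSpan_supportFace_le P v h
  rwa [Submodule.mem_orthogonal_singleton_iff_inner_right, real_inner_comm] at this

theorem eventually_mem_of_mem_edgeNormals {P : Set E3} (hP : IsPolytope P) {u v : E3}
    (hv : v ∈ edgeNormals P u) :
    ∀ᶠ v' in nhds v, v' ∈ perpPlane u → v' ∈ polytopeNormalCone P (supportFace P v) := by
  filter_upwards [hP.eventually_mem_polytopeNormalCone v] with v' h hv'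
  refine h fun x hx => ?_
  rw [show vectorSpan ℝ (supportFace P v) = ℝ ∙ u from hv] at hx
  obtain ⟨c, rfl⟩ := Submodule.mem_span_singleton.1 hx
  rw [real_inner_smul_right, real_inner_comm, mem_perpPlane.1 hv', mul_zero]

theorem polytopeNormalCone_subset_perpPlane {P : Set E3} {u v : E3}
    (hv : v ∈ edgeNormals P u) : polytopeNormalCone P (supportFace P v) ⊆ perpPlane u := by
  intro v' hv'
  rw [mem_polytopeNormalCone_supportFace] at hv'
  have h1 := (vectorSpan_mono ℝ hv').trans (vectorSpan_supportFace_le P v')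
  rw [show vectorSpan ℝ (supportFace P v) = ℝ ∙ u from hv] at h1
  have := h1 (Submodule.mem_span_singleton_self u)
  rwa [Submodule.mem_orthogonal_singleton_iff_inner_left] at this

theorem vectorSpan_polytopeNormalCone {P : Set E3} (hP : IsPolytope P) {u v : E3}
    (hv : v ∈ edgeNormals P u) :
    vectorSpan ℝ (polytopeNormalCone P (supportFace P v)) = (ℝ ∙ u)ᗮ := by
  apply le_antisymm
  · rw [vectorSpan_def, Submodule.span_le]
    have hsub := polytopeNormalCone_subset_perpPlane hv
    rw [← coe_orthogonal_span] at hsub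
    rintro _ ⟨x, hx, y, hy, rfl⟩
    exact Submodule.sub_mem _ (hsub hx) (hsub hy)
  · refine le_vectorSpan_of_eventually (v := v) ?_ ?_
    · exact Submodule.mem_orthogonal_singleton_iff_inner_right.2
        (inner_eq_zero_of_mem_edgeNormals hv)
    · filter_upwards [eventually_mem_of_mem_edgeNormals hP hv] with v' h h'
      exact h (Submodule.mem_orthogonal_singleton_iff_inner_right.1 h')

/-- The normal cone at a vertex contains a neighbourhood of any vector exposing that vertex, so it
is 3-dimensional. -/
theorem vectorSpan_ne_bot_of_setDim_normalCone {P : Set E3} (hP : IsPolytope P) {v : E3}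
    (hdim : setDim (polytopeNormalCone P (supportFace P v)) = 2) :
    vectorSpan ℝ (supportFace P v) ≠ ⊥ := by
  intro hbot
  have h1 : (⊤ : Submodule ℝ E3) ≤ vectorSpan ℝ (polytopeNormalCone P (supportFace P v)) := by
    refine le_vectorSpan_of_eventually (v := v) trivial ?_
    filter_upwards [hP.eventually_mem_polytopeNormalCone v] with v' h _
    refine h fun x hx => ?_
    rw [hbot, Submodule.mem_bot] at hx
    rw [hx, inner_zero_right]
  rw [setDim, top_le_iff.1 h1] at hdim
  simp at hdim

/-- The aggregated cone is the union of the normal cones of the edges of direction `u`. -/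
theorem mem_aggregatedCone_iff {P : Set E3} (hP : IsPolytope P) (hne : P.Nonempty) {u : E3}
    (hu : u ≠ 0) {v' : E3} :
    v' ∈ aggregatedCone P u ↔
      ∃ v ∈ edgeNormals P u, v' ∈ polytopeNormalCone P (supportFace P v) := by
  constructor
  · rintro ⟨_, ⟨F, hF, rfl, hdim, hsub⟩, hv'⟩
    obtain ⟨v, rfl⟩ := hF.exists_supportFace
    refine ⟨v, ?_, hv'⟩
    have hspan := vectorSpan_of_subset_perpPlane hu hdim hsub
    -- A difference of two points of the face is orthogonal to the cone, hence to all of `u^⊥`,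
    -- which the cone spans.
    have hle : vectorSpan ℝ (supportFace P v) ≤ ℝ ∙ u := by
      rw [vectorSpan_def, Submodule.span_le]
      rintro _ ⟨x, hx, y, hy, rfl⟩
      have h1 := polytopeNormalCone_subset_perpPlane_sub (fun z hz => hz.1) hx hy
      rw [← coe_orthogonal_span] at h1
      have h2 : (ℝ ∙ u)ᗮ ≤ (ℝ ∙ (x - y))ᗮ := by
        rw [← hspan, vectorSpan_def, Submodule.span_le]
        rintro _ ⟨p, hp, q, hq, rfl⟩
        exact Submodule.sub_mem _ (h1 hp) (h1 hq)
      have h3 := Submodule.orthogonal_le h2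
      rw [Submodule.orthogonal_orthogonal, Submodule.orthogonal_orthogonal] at h3
      exact h3 (Submodule.mem_span_singleton_self _)
    refine le_antisymm hle ?_
    obtain ⟨x, hx, hx0⟩ := Submodule.exists_mem_ne_zero_of_ne_bot
      (vectorSpan_ne_bot_of_setDim_normalCone hP hdim)
    obtain ⟨c, rfl⟩ := Submodule.mem_span_singleton.1 (hle hx)
    have hc : c ≠ 0 := by rintro rfl; simp at hx0
    rw [Submodule.span_singleton_le_iff_mem]
    have := (vectorSpan ℝ (supportFace P v)).smul_mem c⁻¹ hx
    rwa [smul_smul, inv_mul_cancel₀ hc, one_smul] at this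
  · rintro ⟨v, hv, hv'⟩
    refine ⟨_, ⟨_, isFace_supportFace hP.isCompact hne v, rfl, ?_,
      polytopeNormalCone_subset_perpPlane hv⟩, hv'⟩
    rw [setDim, vectorSpan_polytopeNormalCone hP hv, finrank_orthogonal_span hu]

theorem isClosed_aggregatedCone {P : Set E3} (hP : IsPolytope P) (u : E3) :
    IsClosed (aggregatedCone P u) := by
  rw [aggregatedCone, Set.sUnion_eq_biUnion]
  refine Set.Finite.isClosed_biUnion ?_ ?_
  · refine (hP.finite_setOf_isFace.image (polytopeNormalCone P)).subset ?_
    rintro _ ⟨F, hF, rfl, -⟩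
    exact ⟨F, hF, rfl⟩
  · rintro _ ⟨F, hF, rfl, -⟩
    exact isClosed_polytopeNormalCone P F

theorem smul_mem_aggregatedCone {P : Set E3} {u v : E3} {c : ℝ} (hc : 0 ≤ c)
    (hv : v ∈ aggregatedCone P u) : c • v ∈ aggregatedCone P u := by
  obtain ⟨_, ⟨F, hF, rfl, h⟩, hv⟩ := hv
  exact ⟨_, ⟨F, hF, rfl, h⟩, smul_mem_polytopeNormalCone hc hv⟩

theorem aggregatedCone_subset (P : Set E3) (u : E3) : aggregatedCone P u ⊆ perpPlane u := by
  rintro v ⟨_, ⟨F, hF, rfl, -, h⟩, hv⟩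
  exact h hv

/-! ### Directions parallel to no facet -/

/-- `w` is not parallel to a facet of `P`. -/
def FacetGeneric (P : Set E3) (w : E3) : Prop :=
  ∀ F, IsFacet P F → w ∉ vectorSpan ℝ F

theorem FacetGeneric.smul {P : Set E3} {w : E3} (h : FacetGeneric P w) {c : ℝ} (hc : c ≠ 0) :
    FacetGeneric P (c • w) := fun F hF hw =>
  h F hF (((vectorSpan ℝ F).smul_mem_iff hc).1 hw)

/-- A face exposed by `v` is parallel to `v^⊥`. If it were 2-dimensional it would be a facet with
direction plane `v^⊥`, which contains `w`. -/
theorem FacetGeneric.finrank_le_one {P : Set E3} (hP : IsPolytope P) (hne : P.Nonempty) {w v : E3}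
    (hw : FacetGeneric P w) (hv : v ≠ 0) (hvw : inner ℝ v w = 0) :
    Module.finrank ℝ (vectorSpan ℝ (supportFace P v)) ≤ 1 := by
  by_contra! h
  have hle := vectorSpan_supportFace_le P v
  have h2 := Submodule.finrank_mono hle
  rw [finrank_orthogonal_span hv] at h2
  have heq := Submodule.eq_of_le_of_finrank_eq hle (by rw [finrank_orthogonal_span hv]; omega)
  refine hw _ ⟨isFace_supportFace hP.isCompact hne v, ?_⟩ ?_
  · exact le_antisymm h2 h
  · rw [heq]
    exact Submodule.mem_orthogonal_singleton_iff_inner_right.2 hvw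

/-- The face exposed by a vector of `C(u)` contains an edge of direction `u`; genericity prevents it
from having larger dimension. Thus generic vectors of `C(u)` avoid its relative boundary. -/
theorem FacetGeneric.mem_edgeNormals {P : Set E3} (hP : IsPolytope P) (hne : P.Nonempty)
    {w v u : E3} (hw : FacetGeneric P w) (hv : v ≠ 0) (hvw : inner ℝ v w = 0) (hu : u ≠ 0)
    (h : v ∈ aggregatedCone P u) : v ∈ edgeNormals P u := by
  obtain ⟨v', hv', hv⟩ := (mem_aggregatedCone_iff hP hne hu).1 h
  rw [mem_polytopeNormalCone_supportFace] at hv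
  have h1 := vectorSpan_mono ℝ hv
  rw [show vectorSpan ℝ (supportFace P v') = ℝ ∙ u from hv'] at h1
  refine (Submodule.eq_of_le_of_finrank_le h1 ?_).symm
  rw [finrank_span_singleton hu]
  exact hw.finrank_le_one hP hne ‹_› hvw

theorem mem_aggregatedCone_of_mem_edgeNormals {P : Set E3} (hP : IsPolytope P) (hne : P.Nonempty)
    {v u : E3} (hu : u ≠ 0) (h : v ∈ edgeNormals P u) : v ∈ aggregatedCone P u :=
  (mem_aggregatedCone_iff hP hne hu).2 ⟨v, h, self_mem_polytopeNormalCone P v⟩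

theorem not_inner_eq_const {P : Set E3} (hdim : setDim P = 3) {m : E3} (hm : m ≠ 0) {x₀ : E3}
    (h : ∀ x ∈ P, inner ℝ m x = inner ℝ m x₀) : False := by
  have h1 : vectorSpan ℝ P ≤ (ℝ ∙ m)ᗮ := by
    rw [vectorSpan_def, Submodule.span_le]
    rintro _ ⟨x, hx, y, hy, rfl⟩
    simp only [SetLike.mem_coe, Submodule.mem_orthogonal_singleton_iff_inner_right, vsub_eq_sub,
      inner_sub_right, h x hx, h y hy, sub_self]
  rw [vectorSpan_eq_top hdim] at h1
  have h2 : m ∈ (ℝ ∙ m)ᗮ := h1 trivial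
  rw [Submodule.mem_orthogonal_singleton_iff_inner_right, inner_self_eq_zero] at h2
  exact hm h2

theorem ne_zero_of_mem_edgeNormals {P : Set E3} (hdim : setDim P = 3) {u v : E3}
    (hv : v ∈ edgeNormals P u) : v ≠ 0 := by
  rintro rfl
  have h1 : supportFace P 0 = P := by ext x; simp [supportFace]
  have h2 : vectorSpan ℝ (supportFace P 0) = ℝ ∙ u := hv
  rw [h1, vectorSpan_eq_top hdim] at h2
  have h3 := finrank_span_le_card (R := ℝ) ({u} : Set E3)
  rw [← h2] at h3
  simp at h3

theorem inner_le_of_convexHull {s : Set E3} {n : E3} {c : ℝ} (h : ∀ p ∈ s, inner ℝ n p ≤ c)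
    {y : E3} (hy : y ∈ convexHull ℝ s) : inner ℝ n y ≤ c :=
  convexHull_min (t := {z | inner ℝ n z ≤ c}) h (convex_halfSpace_le (innerₛₗ ℝ n).isLinear _) hy

/-- Rotating the normal vector of an edge around the edge until the face it exposes grows. -/
theorem exists_facet_of_inner_neg {s : Set E3} (hs : s.Finite) {u v m x₀ p : E3} (hu : u ≠ 0)
    (hv0 : v ≠ 0) (hv : v ∈ edgeNormals (convexHull ℝ s) u) (hmu : inner ℝ u m = 0)
    (hmv : inner ℝ v m = 0) (hx₀ : x₀ ∈ supportFace (convexHull ℝ s) v) (hp : p ∈ s)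
    (hlt : inner ℝ m (x₀ - p) < 0) :
    ∃ F, IsFacet (convexHull ℝ s) F ∧ u ∈ vectorSpan ℝ F := by
  -- The least ratio is the largest `t` for which `v + t • m` still attains its maximum at `x₀`; at
  -- that moment the generator `q` joins the face.
  obtain ⟨q, ⟨hqs, hq⟩, hmin⟩ := Set.exists_min_image {p ∈ s | inner ℝ m (x₀ - p) < 0}
    (fun p => inner ℝ v (x₀ - p) / -inner ℝ m (x₀ - p)) (hs.subset (Set.sep_subset _ _))
    ⟨p, hp, hlt⟩
  set t := inner ℝ v (x₀ - q) / -inner ℝ m (x₀ - q) with ht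
  have hpos : ∀ p ∈ s, 0 ≤ inner ℝ v (x₀ - p) := by
    intro p hp
    rw [inner_sub_right, sub_nonneg]
    exact hx₀.2 p (subset_convexHull ℝ s hp)
  have ht0 : 0 ≤ t := div_nonneg (hpos q hqs) (by linarith)
  have hn : ∀ p ∈ s, 0 ≤ inner ℝ (v + t • m) (x₀ - p) := by
    intro p hp
    rw [inner_add_left, real_inner_smul_left]
    rcases lt_or_ge (inner ℝ m (x₀ - p)) 0 with h | h
    · have h1 := hmin p ⟨hp, h⟩
      rw [le_div_iff₀ (by linarith)] at h1
      linarith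
    · have := hpos p hp
      positivity
  have hx₁ : x₀ ∈ supportFace (convexHull ℝ s) (v + t • m) := by
    refine ⟨hx₀.1, fun y hy => inner_le_of_convexHull (fun p hp => ?_) hy⟩
    have := hn p hp
    rwa [inner_sub_right, sub_nonneg] at this
  have hq1 : q ∈ supportFace (convexHull ℝ s) (v + t • m) := by
    refine mem_supportFace_of_inner_eq hx₁ (subset_convexHull ℝ s hqs) ?_
    rw [← sub_eq_zero, ← inner_sub_right, inner_add_left, real_inner_smul_left, ht,
      div_neg, neg_mul, div_mul_cancel₀ _ hq.ne, add_neg_cancel]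
  have hnu : inner ℝ (v + t • m) u = 0 := by
    rw [real_inner_comm, inner_add_right, real_inner_smul_right, hmu,
      inner_eq_zero_of_mem_edgeNormals hv]
    ring
  have hsub : supportFace (convexHull ℝ s) v ⊆ supportFace (convexHull ℝ s) (v + t • m) := by
    intro y hy
    refine mem_supportFace_of_inner_eq hx₁ hy.1 ?_
    have h1 := sub_mem_vectorSpan hx₀ hy
    rw [show vectorSpan ℝ (supportFace (convexHull ℝ s) v) = ℝ ∙ u from hv] at h1
    obtain ⟨c, hc⟩ := Submodule.mem_span_singleton.1 h1
    rw [← sub_eq_zero, ← inner_sub_right, ← hc, real_inner_smul_right, hnu, mul_zero]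
  have hspan : ℝ ∙ u ≤ vectorSpan ℝ (supportFace (convexHull ℝ s) (v + t • m)) := by
    rw [← show vectorSpan ℝ (supportFace (convexHull ℝ s) v) = ℝ ∙ u from hv]
    exact vectorSpan_mono ℝ hsub
  have hn0 : v + t • m ≠ 0 := by
    intro h
    have h1 : inner ℝ v (v + t • m) = (0 : ℝ) := by rw [h, inner_zero_right]
    rw [inner_add_right, real_inner_smul_right, hmv, mul_zero, add_zero, inner_self_eq_zero] at h1
    exact hv0 h1
  refine ⟨_, ⟨isFace_supportFace (hs.isCompact_convexHull ℝ) ⟨x₀, hx₀.1⟩ _, le_antisymm ?_ ?_⟩,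
    hspan (Submodule.mem_span_singleton_self u)⟩
  · have := Submodule.finrank_mono (vectorSpan_supportFace_le (convexHull ℝ s) (v + t • m))
    rwa [finrank_orthogonal_span hn0] at this
  · have hlt : ℝ ∙ u < vectorSpan ℝ (supportFace (convexHull ℝ s) (v + t • m)) := by
      refine lt_of_le_of_ne hspan fun h => ?_
      have h1 := sub_mem_vectorSpan hx₁ hq1
      rw [← h] at h1
      obtain ⟨c, hc⟩ := Submodule.mem_span_singleton.1 h1
      rw [← hc, real_inner_smul_right, real_inner_comm, hmu, mul_zero] at hq
      exact lt_irrefl _ hq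
    have := Submodule.finrank_lt_finrank_of_lt hlt
    rw [finrank_span_singleton hu] at this
    exact this

theorem cross3_ne_zero {u v : E3} (hu : u ≠ 0) (hv : v ≠ 0) (h : inner ℝ u v = 0) :
    cross3 u v ≠ 0 := by
  intro h0
  obtain ⟨c, rfl⟩ := exists_smul_of_cross3_eq_zero hu h0
  rw [real_inner_smul_right, mul_eq_zero, inner_self_eq_zero] at h
  rcases h with rfl | h
  · simp at hv
  · exact hu h

/-- Every edge lies in a facet. -/
theorem exists_facet_of_mem_edgeNormals {P : Set E3} (hP : IsPolytope P) (hdim : setDim P = 3)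
    {u v : E3} (hu : u ≠ 0) (hv : v ∈ edgeNormals P u) :
    ∃ F, IsFacet P F ∧ u ∈ vectorSpan ℝ F := by
  have hv0 := ne_zero_of_mem_edgeNormals hdim hv
  have huv := inner_eq_zero_of_mem_edgeNormals hv
  have hm := cross3_ne_zero hu hv0 huv
  have hne := nonempty_of_setDim hdim
  obtain ⟨s, hs, rfl⟩ := hP
  obtain ⟨x₀, hx₀⟩ := supportFace_nonempty (hs.isCompact_convexHull ℝ) hne v
  by_contra hno
  refine not_inner_eq_const hdim hm (x₀ := x₀) fun x hx => ?_
  have key : ∀ m, inner ℝ u m = 0 → inner ℝ v m = 0 → inner ℝ m x ≤ inner ℝ m x₀ := by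
    intro m hmu hmv
    refine inner_le_of_convexHull (fun p hp => ?_) hx
    by_contra! h
    refine hno (exists_facet_of_inner_neg hs hu hv0 hv hmu hmv hx₀ hp ?_)
    rw [inner_sub_right]
    linarith
  have h1 := key _ (inner_self_cross3 u v) (inner_cross3_self u v)
  have h2 := key (-cross3 u v) (by rw [inner_neg_right, inner_self_cross3, neg_zero])
    (by rw [inner_neg_right, inner_cross3_self, neg_zero])
  rw [inner_neg_left, inner_neg_left] at h2
  linarith

theorem FacetGeneric.cross3_ne_zero {P : Set E3} (hP : IsPolytope P) (hdim : setDim P = 3)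
    {w u v : E3} (hw : FacetGeneric P w) (hu : u ≠ 0) (hv : v ∈ edgeNormals P u) :
    cross3 w u ≠ 0 := by
  obtain ⟨F, hF, huF⟩ := exists_facet_of_mem_edgeNormals hP hdim hu hv
  intro h
  have hw' := hw F hF
  obtain ⟨c, hc⟩ := exists_smul_of_cross3_eq_zero (a := u) (b := w) hu
    (by rw [cross3_anticomm, h, neg_zero])
  exact hw' (hc ▸ (vectorSpan ℝ F).smul_mem c huF)

/-! ### Normalized edge directions -/

theorem exists_firstPos_smul {d : E3} (hd : d ≠ 0) :
    ∃ u : E3, ‖u‖ = 1 ∧ (∃ i : Fin 3, 0 < u i ∧ ∀ j < i, u j = 0) ∧ ∃ c : ℝ, c ≠ 0 ∧ d = c • u := by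
  have hn : 0 < ‖d‖ := norm_pos_iff.2 hd
  have h1 : ∃ i : Fin 3, d i ≠ 0 ∧ ∀ j < i, d j = 0 := by
    by_cases h0 : d 0 = 0
    · by_cases h1 : d 1 = 0
      · refine ⟨2, fun h2 => hd (ext_coords h0 h1 h2), fun j hj => ?_⟩
        fin_cases j <;> simp_all
      · refine ⟨1, h1, fun j hj => ?_⟩
        fin_cases j <;> simp_all
    · exact ⟨0, h0, fun j hj => absurd hj (by simp)⟩
  obtain ⟨i, hi, hj⟩ := h1
  have hz : ∀ c : ℝ, ∀ j < i, (c • d) j = 0 := fun c j hji => by simp [hj j hji]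
  rcases lt_or_gt_of_ne hi with h | h
  · refine ⟨(-‖d‖⁻¹) • d, ?_, ⟨i, ?_, hz _⟩, -‖d‖, by simpa using hd, ?_⟩
    · rw [norm_smul, norm_neg, norm_inv, norm_norm, inv_mul_cancel₀ hn.ne']
    · simpa using mul_neg_of_pos_of_neg (inv_pos.2 hn) h
    · rw [smul_smul, neg_mul_neg, mul_inv_cancel₀ hn.ne', one_smul]
  · refine ⟨‖d‖⁻¹ • d, ?_, ⟨i, ?_, hz _⟩, ‖d‖, hn.ne', ?_⟩
    · rw [norm_smul, norm_inv, norm_norm, inv_mul_cancel₀ hn.ne']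
    · simpa using mul_pos (inv_pos.2 hn) h
    · rw [smul_smul, mul_inv_cancel₀ hn.ne', one_smul]

/-- The sign convention selects one unit vector on each line, so parallel edges share a single edge
direction and are not counted twice. -/
theorem eq_of_firstPos_of_span_eq {u u' : E3} (hu : ‖u‖ = 1)
    (hp : ∃ i : Fin 3, 0 < u i ∧ ∀ j < i, u j = 0) (hu' : ‖u'‖ = 1)
    (hp' : ∃ i : Fin 3, 0 < u' i ∧ ∀ j < i, u' j = 0) {c : ℝ} (h : u' = c • u) : u' = u := by
  have hc : |c| = 1 := by
    rw [h, norm_smul, hu, mul_one] at hu'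
    exact hu'
  rcases eq_or_eq_neg_of_abs_eq hc with rfl | rfl
  · rw [h, one_smul]
  · exfalso
    obtain ⟨i, hi, hj⟩ := hp
    obtain ⟨i', hi', hj'⟩ := hp'
    have hk : ∀ k, u' k = -u k := fun k => by simp [h]
    rcases lt_trichotomy i i' with hl | rfl | hl
    · have := hj' i hl
      rw [hk] at this
      linarith
    · rw [hk] at hi'
      linarith
    · rw [hk, hj i' hl] at hi'
      simp at hi'

theorem IsEdgeDirection.ne_zero {P : Set E3} {u : E3} (h : IsEdgeDirection P u) : u ≠ 0 := by
  rintro rfl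
  simpa using h.1

/-- A compact convex set that spans a line is a segment. -/
theorem exists_segment_of_vectorSpan_eq {F : Set E3} (hc : IsCompact F) (hconv : Convex ℝ F)
    (hne : F.Nonempty) {u : E3} (hu : u ≠ 0) (h : vectorSpan ℝ F = ℝ ∙ u) :
    ∃ a b : E3, a ≠ b ∧ F = segment ℝ a b ∧ ∃ c : ℝ, b - a = c • u := by
  obtain ⟨a, ha, hmin⟩ := hc.exists_isMinOn hne (f := fun y => inner ℝ u y) (by fun_prop)
  obtain ⟨b, hb, hmax⟩ := hc.exists_isMaxOn hne (f := fun y => inner ℝ u y) (by fun_prop)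
  have hline : ∀ x ∈ F, ∀ y ∈ F, ∃ c : ℝ, c • u = x - y := fun x hx y hy =>
    Submodule.mem_span_singleton.1 (h ▸ sub_mem_vectorSpan hx hy)
  have hpos : 0 < inner ℝ u u := real_inner_self_pos.2 hu
  obtain ⟨c, hc⟩ := hline b hb a ha
  have hval : ∀ x ∈ F, ∀ d : ℝ, d • u = x - a → 0 ≤ d ∧ d ≤ c := by
    intro x hx d hd
    have h1 : inner ℝ u a ≤ inner ℝ u x := hmin hx
    have h2 : inner ℝ u x ≤ inner ℝ u b := hmax hx
    have h3 : d * inner ℝ u u = inner ℝ u x - inner ℝ u a := by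
      rw [← real_inner_smul_right, hd, inner_sub_right]
    have h4 : c * inner ℝ u u = inner ℝ u b - inner ℝ u a := by
      rw [← real_inner_smul_right, hc, inner_sub_right]
    constructor
    · by_contra! hlt
      nlinarith
    · by_contra! hlt
      nlinarith
  have hc0 : c ≠ 0 := by
    rintro rfl
    have hsing : F ⊆ {a} := by
      intro x hx
      obtain ⟨d, hd⟩ := hline x hx a ha
      obtain ⟨h1, h2⟩ := hval x hx d hd
      rw [le_antisymm h2 h1, zero_smul] at hd
      exact sub_eq_zero.1 hd.symm
    have h1 := vectorSpan_mono ℝ hsing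
    rw [h, vectorSpan_singleton, le_bot_iff, Submodule.span_singleton_eq_bot] at h1
    exact hu h1
  refine ⟨a, b, ?_, ?_, c, hc.symm⟩
  · rintro rfl
    rw [sub_self, smul_eq_zero] at hc
    tauto
  · refine subset_antisymm (fun x hx => ?_) (hconv.segment_subset ha hb)
    obtain ⟨d, hd⟩ := hline x hx a ha
    obtain ⟨h1, h2⟩ := hval x hx d hd
    have hcpos : 0 < c := lt_of_le_of_ne (h1.trans h2) hc0.symm
    rw [segment_eq_image']
    refine ⟨d / c, ⟨by positivity, (div_le_one hcpos).2 h2⟩, ?_⟩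
    simp only
    rw [← hc, smul_smul, div_mul_cancel₀ _ hc0, hd]
    abel

theorem isEdgeDirection_iff {P : Set E3} (hP : IsPolytope P) (hne : P.Nonempty) {u : E3} :
    IsEdgeDirection P u ↔
      ‖u‖ = 1 ∧ (∃ i : Fin 3, 0 < u i ∧ ∀ j < i, u j = 0) ∧ (edgeNormals P u).Nonempty := by
  constructor
  · rintro ⟨hu, hi, a, b, ⟨hab, hF⟩, c, hc⟩
    refine ⟨hu, hi, ?_⟩
    obtain ⟨v, hv⟩ := hF.exists_supportFace
    refine ⟨v, ?_⟩
    have hc0 : c ≠ 0 := by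
      rintro rfl
      rw [zero_smul, sub_eq_zero] at hc
      exact hab hc.symm
    rw [edgeNormals, Set.mem_ofPred_eq, ← hv, vectorSpan_segment, vsub_eq_sub, hc]
    exact Submodule.span_singleton_smul_eq (isUnit_iff_ne_zero.2 hc0) u
  · rintro ⟨hu, hi, v, hv⟩
    have hu0 : u ≠ 0 := by
      rintro rfl
      simp at hu
    have hF := isFace_supportFace hP.isCompact hne v
    obtain ⟨a, b, hab, heq, hc⟩ := exists_segment_of_vectorSpan_eq (hF.2.isCompact hP.isCompact)
      (hF.2.convex hP.convex) hF.1 hu0 hv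
    exact ⟨hu, hi, a, b, ⟨hab, heq ▸ hF⟩, hc⟩

theorem IsEdgeDirection.eq_of_smul {P : Set E3} {u u' : E3} (hu : IsEdgeDirection P u)
    (hu' : IsEdgeDirection P u') {c : ℝ} (h : u' = c • u) : u' = u :=
  eq_of_firstPos_of_span_eq hu.1 hu.2.1 hu'.1 hu'.2.1 h

theorem finite_setOf_isEdgeDirection {P : Set E3} (hP : IsPolytope P) (hne : P.Nonempty) :
    {u | IsEdgeDirection P u}.Finite := by
  refine Set.Finite.of_finite_image (f := fun u => ℝ ∙ u) ?_ ?_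
  · refine (hP.finite_setOf_isFace.image (fun F => vectorSpan ℝ F)).subset ?_
    rintro _ ⟨u, hu, rfl⟩
    obtain ⟨v, hv⟩ := ((isEdgeDirection_iff hP hne).1 hu).2.2
    exact ⟨_, isFace_supportFace hP.isCompact hne v, hv⟩
  · intro u hu u' hu' h
    have h1 : u' ∈ ℝ ∙ u := by
      simp only at h
      rw [h]
      exact Submodule.mem_span_singleton_self u'
    obtain ⟨c, hc⟩ := Submodule.mem_span_singleton.1 h1
    exact (IsEdgeDirection.eq_of_smul hu hu' hc.symm).symm

/-! ### Vertices and edges of a planar polygon -/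

theorem eq_of_orthogonal_frame {w v x y : E3} (hw : ‖w‖ = 1) (hv : ‖v‖ = 1) (hwv : inner ℝ w v = 0)
    (h1 : inner ℝ w x = inner ℝ w y) (h2 : inner ℝ v x = inner ℝ v y)
    (h3 : inner ℝ (cross3 w v) x = inner ℝ (cross3 w v) y) : x = y := by
  have h := smul_eq_of_orthogonal (u := w) (a := v) (b := x - y) hwv
    (by rw [inner_sub_right, h1, sub_self])
  rw [inner_sub_right, inner_sub_right, h2, h3, sub_self, sub_self,
    real_inner_self_eq_norm_sq, real_inner_self_eq_norm_sq, hw, hv] at h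
  simpa [sub_eq_zero] using h

/-- The end points of the faces of a planar set `Q`: the points of the face exposed by `v` that are
extreme in the direction obtained from `v` by a quarter turn about `w`. -/
def faceEnds (Q : Set E3) (w v : E3) : Set E3 :=
  supportFace (supportFace Q v) (cross3 w v)

/-- Separate `p` from the hull of the other generators. Subtracting the component along `w` does not
change the values on the plane of the polygon. -/
theorem exists_exposing_normal {t : Set E3} (ht : t.Finite) {w p : E3} (hw : ‖w‖ = 1)
    (htw : convexHull ℝ t ⊆ perpPlane w) (hp : p ∈ (convexHull ℝ t).extremePoints ℝ) :
    ∃ l, inner ℝ w l = 0 ∧ ∀ x ∈ t, x ≠ p → 0 < inner ℝ l (p - x) := by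
  have hpt := extremePoints_convexHull_subset hp
  have h1 : p ∉ convexHull ℝ (t \ {p}) := by
    intro h
    have h2 := ((convex_convexHull ℝ t).mem_extremePoints_iff_mem_sdiff_convexHull_sdiff.1 hp).2
    refine h2 (convexHull_mono ?_ h)
    exact Set.sdiff_subset_sdiff_left (subset_convexHull ℝ t)
  obtain ⟨f, c, hf, hfp⟩ := geometric_hahn_banach_closed_point (convex_convexHull ℝ (t \ {p}))
    ((ht.subset Set.sdiff_subset).isClosed_convexHull ℝ) h1
  set a := (InnerProductSpace.toDual ℝ E3).symm f with ha
  have hfa : ∀ x, f x = inner ℝ a x := fun x => by simp [ha]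
  have hww : inner ℝ w w = (1 : ℝ) := by rw [real_inner_self_eq_norm_sq, hw, one_pow]
  refine ⟨a - inner ℝ w a • w, ?_, fun x hx hxp => ?_⟩
  · rw [inner_sub_right, real_inner_smul_right, hww]
    ring
  · have h2 := hf x (subset_convexHull ℝ _ ⟨hx, hxp⟩)
    have h3 : inner ℝ w x = 0 := htw (subset_convexHull ℝ t hx)
    have h4 : inner ℝ w p = 0 := htw hp.1
    rw [hfa] at h2 hfp
    rw [inner_sub_left, real_inner_smul_left, inner_sub_right, inner_sub_right, h3, h4]
    linarith

/-- Let `l` expose `p` alone, write `J` for `w ×`, and let `τ` be the largest slope `⟪J l, p - x⟫ /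
⟪l, p - x⟫` over the other generators. Then `v = τ l - J l` supports the polygon along an edge from
`p` to a maximizer `q`. On that edge `⟪J v, p - y⟫ = (τ² + 1) ⟪l, p - y⟫ ≥ 0`, so `p` is the end
selected by the quarter turn. -/
theorem exists_mem_faceEnds {t : Set E3} (ht : t.Finite) {w p : E3} (hw : ‖w‖ = 1)
    (htw : convexHull ℝ t ⊆ perpPlane w) (hp : p ∈ (convexHull ℝ t).extremePoints ℝ)
    (hne : ∃ x ∈ t, x ≠ p) :
    ∃ v, ‖v‖ = 1 ∧ inner ℝ w v = 0 ∧ (supportFace (convexHull ℝ t) v).Nontrivial ∧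
      p ∈ faceEnds (convexHull ℝ t) w v := by
  obtain ⟨l, hwl, hl⟩ := exists_exposing_normal ht hw htw hp
  obtain ⟨x₁, hx₁, hx₁p⟩ := hne
  obtain ⟨q, ⟨hqt, hqp⟩, hmax⟩ := Set.exists_max_image {x ∈ t | x ≠ p}
    (fun x => inner ℝ (cross3 w l) (p - x) / inner ℝ l (p - x)) (ht.subset (Set.sep_subset _ _))
    ⟨x₁, hx₁, hx₁p⟩
  set τ := inner ℝ (cross3 w l) (p - q) / inner ℝ l (p - q) with hτ
  have hlq := hl q hqt hqp
  have hl0 : l ≠ 0 := by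
    rintro rfl
    simp at hlq
  set v := τ • l - cross3 w l with hv
  have hwv : inner ℝ w v = 0 := by
    rw [hv, inner_sub_right, real_inner_smul_right, hwl, inner_self_cross3]
    ring
  have hv0 : v ≠ 0 := by
    intro h
    have h1 : inner ℝ v (cross3 w l) = (0 : ℝ) := by rw [h, inner_zero_left]
    rw [hv, inner_sub_left, real_inner_smul_left, inner_cross3_self, mul_zero, zero_sub,
      neg_eq_zero, inner_cross3_cross3 w l l hw hwl, inner_self_eq_zero] at h1
    exact hl0 h1
  have hval : ∀ z, inner ℝ v z = τ * inner ℝ l z - inner ℝ (cross3 w l) z := fun z => by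
    rw [hv, inner_sub_left, real_inner_smul_left]
  have hJ : cross3 w v = τ • cross3 w l + l := by
    have h1 : inner ℝ w w = (1 : ℝ) := by rw [real_inner_self_eq_norm_sq, hw, one_pow]
    rw [hv, cross3_sub_right, cross3_smul_right, cross3_cross3, hwl, h1]
    module
  have hpos : ∀ x ∈ t, inner ℝ v x ≤ inner ℝ v p := by
    intro x hx
    rcases eq_or_ne x p with rfl | hxp
    · rfl
    · have h1 : _ ≤ τ := hmax x ⟨hx, hxp⟩
      rw [div_le_iff₀ (hl x hx hxp)] at h1
      have h2 := hval (p - x)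
      rw [inner_sub_right] at h2
      linarith
  have hpv : p ∈ supportFace (convexHull ℝ t) v :=
    ⟨hp.1, fun y hy => inner_le_of_convexHull hpos hy⟩
  have hqv : q ∈ supportFace (convexHull ℝ t) v := by
    refine mem_supportFace_of_inner_eq hpv (subset_convexHull ℝ t hqt) ?_
    have h2 := hval (p - q)
    rw [hτ, div_mul_cancel₀ _ hlq.ne', sub_self, inner_sub_right] at h2
    linarith
  have hend : ∀ y ∈ supportFace (convexHull ℝ t) v,
      inner ℝ (cross3 w v) y ≤ inner ℝ (cross3 w v) p := by
    intro y hy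
    have h1 : inner ℝ l y ≤ inner ℝ l p := by
      refine inner_le_of_convexHull (fun x hx => ?_) hy.1
      rcases eq_or_ne x p with rfl | hxp
      · rfl
      · have := hl x hx hxp
        rw [inner_sub_right] at this
        linarith
    have h2 := hval (p - y)
    rw [inner_sub_right, inner_eq_of_mem_supportFace hpv hy, sub_self] at h2
    have h3 : inner ℝ (cross3 w v) (p - y) = (τ ^ 2 + 1) * inner ℝ l (p - y) := by
      rw [hJ, inner_add_left, real_inner_smul_left]
      linear_combination τ * h2
    have h4 : 0 ≤ (τ ^ 2 + 1) * inner ℝ l (p - y) := by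
      refine mul_nonneg (by positivity) ?_
      rw [inner_sub_right]
      linarith
    rw [← h3, inner_sub_right] at h4
    linarith
  have hn : 0 < ‖v‖⁻¹ := inv_pos.2 (norm_pos_iff.2 hv0)
  have hface : supportFace (convexHull ℝ t) (‖v‖⁻¹ • v) = supportFace (convexHull ℝ t) v := by
    ext x
    simp only [supportFace, real_inner_smul_left, Set.mem_ofPred_eq, mul_le_mul_iff_right₀ hn]
  refine ⟨‖v‖⁻¹ • v, ?_, ?_, ?_, ?_⟩
  · rw [norm_smul, norm_inv, norm_norm, inv_mul_cancel₀ (norm_ne_zero_iff.2 hv0)]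
  · rw [real_inner_smul_right, hwv, mul_zero]
  · rw [hface]
    exact ⟨p, hpv, q, hqv, hqp.symm⟩
  · rw [faceEnds, hface, cross3_smul_right]
    refine ⟨hpv, fun y hy => ?_⟩
    rw [real_inner_smul_left, real_inner_smul_left]
    exact mul_le_mul_of_nonneg_left (hend y hy) hn.le

/-- The edge exposed by `v` leaves `p` along `-J v`, where `J` is `w ×`. As `p` also maximizes `v'`,
this gives `⟪v', J v⟫ ≥ 0`, and symmetrically `⟪v, J v'⟫ ≥ 0`. These numbers are opposite, hence
zero, so `v' = ±v`; the minus sign would put the polygon on a line. -/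
theorem eq_of_mem_faceEnds {Q : Set E3} {w p v v' : E3} (hw : ‖w‖ = 1) (hQw : Q ⊆ perpPlane w)
    (hflat : ∀ m, m ≠ 0 → inner ℝ w m = 0 → ∀ x₀ ∈ Q, ∃ x ∈ Q, inner ℝ m x ≠ inner ℝ m x₀)
    (hv : ‖v‖ = 1) (hwv : inner ℝ w v = 0) (hvn : (supportFace Q v).Nontrivial)
    (hv' : ‖v'‖ = 1) (hwv' : inner ℝ w v' = 0) (hvn' : (supportFace Q v').Nontrivial)
    (hp : p ∈ faceEnds Q w v) (hp' : p ∈ faceEnds Q w v') : v = v' := by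
  have hww : inner ℝ w w = (1 : ℝ) := by rw [real_inner_self_eq_norm_sq, hw, one_pow]
  have key : ∀ v v' : E3, ‖v‖ = 1 → inner ℝ w v = 0 → (supportFace Q v).Nontrivial →
      inner ℝ w v' = 0 → p ∈ faceEnds Q w v → p ∈ faceEnds Q w v' →
      0 ≤ inner ℝ v' (cross3 w v) := by
    intro v v' hv hwv hvn hwv' hp hp'
    obtain ⟨q, hq, hqp⟩ := hvn.exists_ne p
    have h1 : inner ℝ v q = inner ℝ v p := inner_eq_of_mem_supportFace hq hp.1
    have h2 := hp.2 q hq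
    have h3 : inner ℝ (cross3 w v) q < inner ℝ (cross3 w v) p := by
      refine lt_of_le_of_ne h2 fun h => hqp ?_
      refine eq_of_orthogonal_frame hw hv hwv ?_ h1 h
      rw [mem_perpPlane.1 (hQw hq.1), mem_perpPlane.1 (hQw hp.1.1)]
    have h4 := hp'.1.2 q hq.1
    have h5 := smul_eq_of_orthogonal (u := w) (a := v) (b := p - q) hwv (by
      rw [inner_sub_right, mem_perpPlane.1 (hQw hq.1), mem_perpPlane.1 (hQw hp.1.1), sub_self])
    rw [hww, real_inner_self_eq_norm_sq, hv, inner_sub_right v, h1] at h5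
    have h6 := congrArg (fun z => inner ℝ v' z) h5
    simp only [inner_add_right, real_inner_smul_right, inner_sub_right] at h6
    by_contra! hlt
    nlinarith
  have h1 := key v v' hv hwv hvn hwv' hp hp'
  have h2 := key v' v hv' hwv' hvn' hwv hp' hp
  have h3 : inner ℝ v' (cross3 w v) = -inner ℝ v (cross3 w v') := by
    rw [inner_cross3_swap]
  have h4 : inner ℝ (cross3 w v) v' = 0 := by rw [real_inner_comm]; linarith
  have h5 := smul_eq_of_orthogonal (u := w) (a := v) (b := v') hwv hwv'
  rw [hww, real_inner_self_eq_norm_sq, hv, h4, zero_smul, add_zero, one_mul, one_pow, one_mul,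
    one_smul] at h5
  have h6 : |inner ℝ v v'| = 1 := by
    have := congrArg norm h5
    rw [norm_smul, hv, hv', mul_one] at this
    exact this.symm
  rcases eq_or_eq_neg_of_abs_eq h6 with h | h
  · rw [h5, h, one_smul]
  · exfalso
    rw [h, neg_one_smul] at h5
    obtain ⟨x, hx, hxp⟩ := hflat v (by rintro rfl; simp at hv) hwv p hp.1.1
    have h7 := hp'.1.2 x hx
    rw [h5, inner_neg_left, inner_neg_left] at h7
    exact hxp (le_antisymm (hp.1.2 x hx) (by linarith))

/-- A planar polygon has as many vertices as edges. -/
theorem ncard_extremePoints_eq_ncard_edges {t : Set E3} (ht : t.Finite) {w : E3} (hw : ‖w‖ = 1)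
    (htw : convexHull ℝ t ⊆ perpPlane w)
    (hflat : ∀ m, m ≠ 0 → inner ℝ w m = 0 → ∀ x₀ ∈ convexHull ℝ t,
      ∃ x ∈ convexHull ℝ t, inner ℝ m x ≠ inner ℝ m x₀) :
    ((convexHull ℝ t).extremePoints ℝ).ncard =
      {v | ‖v‖ = 1 ∧ inner ℝ w v = 0 ∧ (supportFace (convexHull ℝ t) v).Nontrivial}.ncard := by
  symm
  have hc := ht.isCompact_convexHull ℝ
  have hex : ∀ v, ‖v‖ = 1 ∧ inner ℝ w v = 0 ∧ (supportFace (convexHull ℝ t) v).Nontrivial →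
      ∃ p, p ∈ faceEnds (convexHull ℝ t) w v := fun v hv =>
    supportFace_nonempty ((supportFace_isExposed _ v).isCompact hc) hv.2.2.nonempty _
  have huniq : ∀ v, ‖v‖ = 1 → inner ℝ w v = 0 → ∀ p q, p ∈ faceEnds (convexHull ℝ t) w v →
      q ∈ faceEnds (convexHull ℝ t) w v → p = q := by
    intro v hv hwv p q hp hq
    refine eq_of_orthogonal_frame hw hv hwv ?_ (inner_eq_of_mem_supportFace hp.1 hq.1)
      (inner_eq_of_mem_supportFace hp hq)
    rw [mem_perpPlane.1 (htw hp.1.1), mem_perpPlane.1 (htw hq.1.1)]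
  -- Each edge normal is sent to the end of its edge in the quarter-turn direction. Always choosing
  -- this end orients the boundary, so no vertex is reached twice.
  refine Set.ncard_congr (fun v hv => (hex v hv).choose) ?_ ?_ ?_
  · intro v hv
    have hp := (hex v hv).choose_spec
    set p := (hex v hv).choose
    have hsing : faceEnds (convexHull ℝ t) w v = {p} :=
      Set.eq_singleton_iff_unique_mem.2 ⟨hp, fun q hq => huniq v hv.1 hv.2.1 q p hq hp⟩
    rw [← isExtreme_singleton, ← hsing]
    exact (supportFace_isExposed _ v).isExtreme.trans (supportFace_isExposed _ _).isExtreme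
  · intro v v' hv hv' h
    have h1 := (hex v hv).choose_spec
    have h2 := (hex v' hv').choose_spec
    rw [h] at h1
    exact eq_of_mem_faceEnds hw htw hflat hv.1 hv.2.1 hv.2.2 hv'.1 hv'.2.1 hv'.2.2 h1 h2
  · intro p hp
    have hne : ∃ x ∈ t, x ≠ p := by
      by_contra! h
      obtain ⟨m, hm, hwm⟩ : ∃ m : E3, m ≠ 0 ∧ inner ℝ w m = 0 := by
        have hw0 : w ≠ 0 := by rintro rfl; simp at hw
        have hr := finrank_orthogonal_span hw0
        have hb : (ℝ ∙ w)ᗮ ≠ ⊥ := by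
          intro hb
          rw [hb, finrank_bot] at hr
          omega
        obtain ⟨m, hm, hm0⟩ := Submodule.exists_mem_ne_zero_of_ne_bot hb
        exact ⟨m, hm0, Submodule.mem_orthogonal_singleton_iff_inner_right.1 hm⟩
      obtain ⟨x, hx, hxp⟩ := hflat m hm hwm p hp.1
      have hsub : convexHull ℝ t ⊆ {p} := convexHull_min (fun x hx => h x hx) (convex_singleton p)
      exact hxp (by rw [hsub hx])
    obtain ⟨v, hv, hwv, hvn, hpv⟩ := exists_mem_faceEnds ht hw htw hp hne
    exact ⟨v, ⟨hv, hwv, hvn⟩, huniq v hv hwv _ _ (hex v ⟨hv, hwv, hvn⟩).choose_spec hpv⟩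

/-! ### Counting the vertices of a projection -/

theorem smul_mem_aggregatedCone_iff {P : Set E3} {u v : E3} {c : ℝ} (hc : 0 < c) :
    c • v ∈ aggregatedCone P u ↔ v ∈ aggregatedCone P u := by
  refine ⟨fun h => ?_, smul_mem_aggregatedCone hc.le⟩
  have := smul_mem_aggregatedCone (inv_nonneg.2 hc.le) h
  rwa [smul_smul, inv_mul_cancel₀ hc.ne', one_smul] at this

open Classical in
/-- The number of the vectors `v`, `-v` that belong to the aggregated cone. -/
noncomputable def antipodalCount (P : Set E3) (u v : E3) : ℕ :=
  (if v ∈ aggregatedCone P u then 1 else 0) + (if -v ∈ aggregatedCone P u then 1 else 0)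

theorem antipodalCount_neg (P : Set E3) (u v : E3) :
    antipodalCount P u (-v) = antipodalCount P u v := by
  rw [antipodalCount, antipodalCount, neg_neg, add_comm]

theorem antipodalCount_smul_of_pos (P : Set E3) (u v : E3) {c : ℝ} (hc : 0 < c) :
    antipodalCount P u (c • v) = antipodalCount P u v := by
  classical
  have h : -(c • v) = c • (-v) := (smul_neg c v).symm
  rw [antipodalCount, antipodalCount, h]
  congr 1 <;> exact if_congr (smul_mem_aggregatedCone_iff hc) rfl rfl

theorem antipodalCount_smul (P : Set E3) (u v : E3) {c : ℝ} (hc : c ≠ 0) :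
    antipodalCount P u (c • v) = antipodalCount P u v := by
  rcases lt_or_gt_of_ne hc with h | h
  · rw [← antipodalCount_neg, ← neg_smul, antipodalCount_smul_of_pos _ _ _ (neg_pos.2 h)]
  · exact antipodalCount_smul_of_pos _ _ _ h

theorem supportFace_starProjection_image (H : Submodule ℝ E3) (P : Set E3) {v : E3} (hv : v ∈ H) :
    supportFace (H.starProjection '' P) v = H.starProjection '' supportFace P v := by
  have h : ∀ x, inner ℝ v (H.starProjection x) = inner ℝ v x := fun x => by
    rw [← Submodule.inner_starProjection_left_eq_right, Submodule.starProjection_eq_self_iff.2 hv]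
  ext y
  constructor
  · rintro ⟨⟨x, hx, rfl⟩, hy⟩
    refine ⟨x, ⟨hx, fun z hz => ?_⟩, rfl⟩
    have := hy _ ⟨z, hz, rfl⟩
    rwa [h, h] at this
  · rintro ⟨x, hx, rfl⟩
    refine ⟨⟨x, hx.1, rfl⟩, ?_⟩
    rintro _ ⟨z, hz, rfl⟩
    rw [h, h]
    exact hx.2 z hz

theorem IsPolytope.image_starProjection {P : Set E3} (hP : IsPolytope P) (H : Submodule ℝ E3) :
    IsPolytope (H.starProjection '' P) := by
  obtain ⟨s, hs, rfl⟩ := hP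
  exact ⟨H.starProjection '' s, hs.image _,
    (H.starProjection : E3 →ₗ[ℝ] E3).image_convexHull s⟩

/-- Genericity bounds the dimension of the exposed face by 1, and since every edge lies in a facet,
`w` is parallel to no edge, so the projection collapses none. -/
theorem edgeNormals_iff_of_generic {P : Set E3} (hP : IsPolytope P) (hdim : setDim P = 3) {w v : E3}
    (hw : FacetGeneric P w) (hv : v ≠ 0) (hwv : inner ℝ w v = 0) :
    (supportFace ((ℝ ∙ w)ᗮ.starProjection '' P) v).Nontrivial ↔
      ∃ u, IsEdgeDirection P u ∧ v ∈ edgeNormals P u := by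
  have hne := nonempty_of_setDim hdim
  rw [supportFace_starProjection_image _ _
    (Submodule.mem_orthogonal_singleton_iff_inner_right.2 hwv)]
  constructor
  · rintro ⟨_, ⟨x, hx, rfl⟩, _, ⟨y, hy, rfl⟩, hxy⟩
    have hd : x - y ≠ 0 := by
      intro h
      rw [sub_eq_zero.1 h] at hxy
      exact hxy rfl
    obtain ⟨u, hu, hi, c, hc, hxyu⟩ := exists_firstPos_smul hd
    have hspan : vectorSpan ℝ (supportFace P v) = ℝ ∙ u := by
      rw [← Submodule.span_singleton_smul_eq (isUnit_iff_ne_zero.2 hc) u, ← hxyu]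
      symm
      refine Submodule.eq_of_le_of_finrank_le ?_ ?_
      · rw [Submodule.span_singleton_le_iff_mem]
        exact sub_mem_vectorSpan hx hy
      · rw [finrank_span_singleton hd]
        exact hw.finrank_le_one hP hne hv (by rwa [real_inner_comm])
    exact ⟨u, (isEdgeDirection_iff hP hne).2 ⟨hu, hi, v, hspan⟩, hspan⟩
  · rintro ⟨u, hu, hvu⟩
    have hcross := hw.cross3_ne_zero hP hdim hu.ne_zero hvu
    rw [← Set.not_subsingleton_iff]
    intro hsub
    have hinj : (supportFace P v).Subsingleton := by
      intro x hx y hy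
      by_contra hxy
      have h1 := hsub ⟨x, hx, rfl⟩ ⟨y, hy, rfl⟩
      rw [← sub_eq_zero, ← map_sub, Submodule.starProjection_apply_eq_zero_iff,
        Submodule.orthogonal_orthogonal] at h1
      obtain ⟨c, hc⟩ := Submodule.mem_span_singleton.1 h1
      have h2 := sub_mem_vectorSpan hx hy
      rw [show vectorSpan ℝ (supportFace P v) = ℝ ∙ u from hvu] at h2
      obtain ⟨d, hd⟩ := Submodule.mem_span_singleton.1 h2
      -- The vector `x - y` is parallel both to `w` and to `u`; its cross product with itself
      -- vanishes although `w × u` does not.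
      have h3 : cross3 (x - y) (x - y) = (c * d) • cross3 w u := by
        nth_rewrite 1 [← hc]
        rw [← hd, cross3_smul_left, cross3_smul_right, smul_smul]
      rw [cross3_self, eq_comm, smul_eq_zero] at h3
      rcases h3 with h3 | h3
      · rcases mul_eq_zero.1 h3 with rfl | rfl
        · rw [zero_smul, eq_comm, sub_eq_zero] at hc
          exact hxy hc
        · rw [zero_smul, eq_comm, sub_eq_zero] at hd
          exact hxy hd
      · exact hcross h3
    have h4 : vectorSpan ℝ (supportFace P v) = ⊥ := by
      obtain ⟨x, hx⟩ := supportFace_nonempty hP.isCompact hne v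
      rw [hinj.eq_singleton_of_mem hx, vectorSpan_singleton]
    rw [show vectorSpan ℝ (supportFace P v) = ℝ ∙ u from hvu,
      Submodule.span_singleton_eq_bot] at h4
    exact hu.ne_zero h4

theorem eq_or_eq_neg_normalized_cross3 {w u v : E3} (hc : cross3 w u ≠ 0) (hv : ‖v‖ = 1)
    (hwv : inner ℝ w v = 0) (huv : inner ℝ u v = 0) :
    v = ‖cross3 w u‖⁻¹ • cross3 w u ∨ v = -(‖cross3 w u‖⁻¹ • cross3 w u) := by
  have h1 : cross3 (cross3 w u) v = 0 := by
    rw [cross3_anticomm, cross3_cross3, real_inner_comm, huv, real_inner_comm, hwv]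
    simp
  obtain ⟨c, rfl⟩ := exists_smul_of_cross3_eq_zero hc h1
  rw [norm_smul, Real.norm_eq_abs] at hv
  rw [← neg_smul]
  have hn := norm_ne_zero_iff.2 hc
  rcases abs_cases c with ⟨h, -⟩ | ⟨h, -⟩
  · left
    rw [h] at hv
    rw [eq_inv_of_mul_eq_one_left hv]
  · right
    rw [h] at hv
    rw [← eq_inv_of_mul_eq_one_left hv, neg_neg]

/-- The vertices are counted through the unit edge normals of the projection. Those coming from `u`
are the vectors `±(w × u)/‖w × u‖` that lie in `C(u)`. -/
theorem ncard_extremePoints_projection {P : Set E3} (hP : IsPolytope P) (hdim : setDim P = 3)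
    (hED : {u | IsEdgeDirection P u}.Finite) {w : E3} (hw1 : ‖w‖ = 1) (hw : FacetGeneric P w) :
    (((ℝ ∙ w)ᗮ.starProjection '' P).extremePoints ℝ).ncard =
      ∑ u ∈ hED.toFinset, antipodalCount P u (cross3 w u) := by
  classical
  have hne := nonempty_of_setDim hdim
  obtain ⟨t, ht, hQ⟩ := hP.image_starProjection (ℝ ∙ w)ᗮ
  have hsub : (ℝ ∙ w)ᗮ.starProjection '' P ⊆ perpPlane w := by
    rintro _ ⟨x, -, rfl⟩
    exact Submodule.mem_orthogonal_singleton_iff_inner_right.1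
      (Submodule.starProjection_apply_mem _ x)
  have hproj : ∀ m x, inner ℝ w m = 0 →
      inner ℝ m ((ℝ ∙ w)ᗮ.starProjection x) = inner ℝ m x := by
    intro m x hm
    rw [← Submodule.inner_starProjection_left_eq_right, Submodule.starProjection_eq_self_iff.2
      (Submodule.mem_orthogonal_singleton_iff_inner_right.2 hm)]
  have hflat : ∀ m, m ≠ 0 → inner ℝ w m = 0 → ∀ x₀ ∈ (ℝ ∙ w)ᗮ.starProjection '' P,
      ∃ x ∈ (ℝ ∙ w)ᗮ.starProjection '' P, inner ℝ m x ≠ inner ℝ m x₀ := by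
    rintro m hm hwm _ ⟨x₀, hx₀, rfl⟩
    by_contra! h
    refine not_inner_eq_const hdim hm (x₀ := x₀) fun x hx => ?_
    have := h _ ⟨x, hx, rfl⟩
    rwa [hproj m _ hwm, hproj m _ hwm] at this
  have hcard := ncard_extremePoints_eq_ncard_edges ht hw1 (hQ ▸ hsub) (hQ ▸ hflat)
  rw [← hQ] at hcard
  rw [hcard]
  set e : E3 → E3 := fun u => ‖cross3 w u‖⁻¹ • cross3 w u with he
  have hcross : ∀ u, IsEdgeDirection P u → cross3 w u ≠ 0 := by
    intro u hu
    obtain ⟨-, -, v, hv⟩ := (isEdgeDirection_iff hP hne).1 hu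
    exact hw.cross3_ne_zero hP hdim hu.ne_zero hv
  have he1 : ∀ u, IsEdgeDirection P u → ‖e u‖ = 1 := by
    intro u hu
    rw [he]
    simp only
    rw [norm_smul, norm_inv, norm_norm, inv_mul_cancel₀ (norm_ne_zero_iff.2 (hcross u hu))]
  have hwe : ∀ u, inner ℝ w (e u) = 0 := fun u => by
    rw [he]
    simp only
    rw [real_inner_smul_right, inner_self_cross3, mul_zero]
  have hmem : ∀ u v, IsEdgeDirection P u → ‖v‖ = 1 → inner ℝ w v = 0 →
      (v ∈ edgeNormals P u ↔ v ∈ aggregatedCone P u) := fun u v hu hv hwv =>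
    ⟨mem_aggregatedCone_of_mem_edgeNormals hP hne hu.ne_zero,
      hw.mem_edgeNormals hP hne (by rintro rfl; simp at hv) (by rwa [real_inner_comm]) hu.ne_zero⟩
  have hset : {v | ‖v‖ = 1 ∧ inner ℝ w v = 0 ∧
      (supportFace ((ℝ ∙ w)ᗮ.starProjection '' P) v).Nontrivial} =
      ↑(hED.toFinset.biUnion fun u =>
        ({e u, -e u} : Finset E3).filter (· ∈ aggregatedCone P u)) := by
    ext v
    simp only [Set.mem_ofPred_eq, Finset.coe_biUnion, Set.mem_iUnion, Finset.mem_coe,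
      Set.Finite.mem_toFinset, Finset.mem_filter, Finset.mem_insert, Finset.mem_singleton,
      exists_prop]
    constructor
    · rintro ⟨hv, hwv, hnt⟩
      obtain ⟨u, hu, hvu⟩ := (edgeNormals_iff_of_generic hP hdim hw
        (by rintro rfl; simp at hv) hwv).1 hnt
      exact ⟨u, hu, eq_or_eq_neg_normalized_cross3 (hcross u hu) hv hwv
        (inner_eq_zero_of_mem_edgeNormals hvu), (hmem u v hu hv hwv).1 hvu⟩
    · rintro ⟨u, hu, hve, hvC⟩
      have hv : ‖v‖ = 1 := by
        rcases hve with rfl | rfl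
        · exact he1 u hu
        · rw [norm_neg, he1 u hu]
      have hwv : inner ℝ w v = 0 := by
        rcases hve with rfl | rfl
        · exact hwe u
        · rw [inner_neg_right, hwe u, neg_zero]
      exact ⟨hv, hwv, (edgeNormals_iff_of_generic hP hdim hw (by rintro rfl; simp at hv) hwv).2
        ⟨u, hu, (hmem u v hu hv hwv).2 hvC⟩⟩
  rw [hset, Set.ncard_coe_finset, Finset.card_biUnion]
  · refine Finset.sum_congr rfl fun u hu => ?_
    have hu' : IsEdgeDirection P u := by simpa using hu
    rw [← antipodalCount_smul_of_pos P u (cross3 w u)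
      (inv_pos.2 (norm_pos_iff.2 (hcross u hu')))]
    have hne' : e u ≠ -e u := by
      intro h
      have h1 := he1 u hu'
      have h2 := eq_neg_iff_add_eq_zero.1 h
      rw [← two_smul ℝ, smul_eq_zero_iff_right two_ne_zero] at h2
      rw [h2] at h1
      simp at h1
    rw [Finset.card_filter, Finset.sum_pair hne', antipodalCount]
  -- The families are disjoint: the face exposed by `v` has only one direction.
  · intro u hu u' hu' huu'
    have hu1 : IsEdgeDirection P u := by simpa using hu
    have hu2 : IsEdgeDirection P u' := by simpa using hu'
    refine Finset.disjoint_left.2 fun v hv hv' => huu' ?_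
    have key : ∀ u, IsEdgeDirection P u →
        v ∈ ({e u, -e u} : Finset E3).filter (· ∈ aggregatedCone P u) → v ∈ edgeNormals P u := by
      intro u hu hv
      simp only [Finset.mem_filter, Finset.mem_insert, Finset.mem_singleton] at hv
      refine (hmem u v hu ?_ ?_).2 hv.2
      · rcases hv.1 with h | h
        · rw [h, he1 u hu]
        · rw [h, norm_neg, he1 u hu]
      · rcases hv.1 with h | h
        · rw [h, hwe u]
        · rw [h, inner_neg_right, hwe u, neg_zero]
    have h1 : vectorSpan ℝ (supportFace P v) = ℝ ∙ u := key u hu1 hv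
    have h2 : vectorSpan ℝ (supportFace P v) = ℝ ∙ u' := key u' hu2 hv'
    have h3 : u' ∈ ℝ ∙ u := by
      rw [← h1, h2]
      exact Submodule.mem_span_singleton_self u'
    obtain ⟨c, hc⟩ := Submodule.mem_span_singleton.1 h3
    exact (hu1.eq_of_smul hu2 hc.symm).symm

/-! ### The relative interior of the opposite cone -/

theorem mem_intrinsicInterior_iff_eventually {S : Set E3} {W : Submodule ℝ E3}
    (hS : affineSpan ℝ S = W.toAffineSubspace) {x : E3} :
    x ∈ intrinsicInterior ℝ S ↔ x ∈ W ∧ ∀ᶠ y in nhds x, y ∈ W → y ∈ S := by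
  rw [intrinsicInterior, hS]
  constructor
  · rintro ⟨⟨y, hy⟩, hint, rfl⟩
    refine ⟨hy, ?_⟩
    rw [mem_interior_iff_mem_nhds] at hint
    exact mem_nhdsWithin_iff_eventually.1 (preimage_coe_mem_nhds_subtype.1 hint)
  · rintro ⟨hx, h⟩
    refine ⟨⟨x, hx⟩, ?_, rfl⟩
    rw [mem_interior_iff_mem_nhds]
    exact preimage_coe_mem_nhds_subtype.2 (mem_nhdsWithin_iff_eventually.2 h)

theorem eventually_mem_aggregatedCone {P : Set E3} (hP : IsPolytope P) (hne : P.Nonempty)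
    {u v : E3} (hu : u ≠ 0) (hv : v ∈ edgeNormals P u) :
    ∀ᶠ y in nhds v, y ∈ perpPlane u → y ∈ aggregatedCone P u := by
  filter_upwards [eventually_mem_of_mem_edgeNormals hP hv] with y hy hyu
  exact (mem_aggregatedCone_iff hP hne hu).2 ⟨v, hv, hy hyu⟩

theorem neg_mem_perpPlane {u v : E3} (h : v ∈ perpPlane u) : -v ∈ perpPlane u := by
  rw [mem_perpPlane, inner_neg_right, mem_perpPlane.1 h, neg_zero]

theorem affineSpan_neg_aggregatedCone {P : Set E3} (hP : IsPolytope P) (hne : P.Nonempty)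
    {u v : E3} (hu : u ≠ 0) (hv : v ∈ edgeNormals P u) :
    affineSpan ℝ (-aggregatedCone P u) = (ℝ ∙ u)ᗮ.toAffineSubspace := by
  have hvC := mem_aggregatedCone_of_mem_edgeNormals hP hne hu hv
  have h0 : (0 : E3) ∈ -aggregatedCone P u := by
    rw [Set.mem_neg, neg_zero]
    simpa using smul_mem_aggregatedCone le_rfl hvC
  refine AffineSubspace.ext_of_direction_eq ?_ ⟨0, subset_affineSpan ℝ _ h0, ?_⟩
  · rw [direction_affineSpan, Submodule.toAffineSubspace_direction]
    apply le_antisymm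
    · rw [vectorSpan_def, Submodule.span_le]
      have hsub : -aggregatedCone P u ⊆ ((ℝ ∙ u)ᗮ : Submodule ℝ E3) := by
        rw [coe_orthogonal_span]
        intro x hx
        simpa using neg_mem_perpPlane (aggregatedCone_subset P u hx)
      rintro _ ⟨x, hx, y, hy, rfl⟩
      exact Submodule.sub_mem _ (hsub hx) (hsub hy)
    · refine le_vectorSpan_of_eventually (v := -v) ?_ ?_
      · exact Submodule.neg_mem _ (Submodule.mem_orthogonal_singleton_iff_inner_right.2
          (inner_eq_zero_of_mem_edgeNormals hv))
      · have ht : Filter.Tendsto (fun y : E3 => -y) (nhds (-v)) (nhds v) := by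
          simpa using (continuous_neg (G := E3)).tendsto (-v)
        filter_upwards [ht.eventually (eventually_mem_aggregatedCone hP hne hu hv)] with y hy hyW
        exact hy (neg_mem_perpPlane (Submodule.mem_orthogonal_singleton_iff_inner_right.1 hyW))
  · exact Submodule.zero_mem _

theorem mem_intrinsicInterior_neg_iff {P : Set E3} (hP : IsPolytope P) (hne : P.Nonempty)
    {u v : E3} (hu : u ≠ 0) (hv : v ∈ edgeNormals P u) {x : E3} :
    x ∈ intrinsicInterior ℝ (-aggregatedCone P u) ↔
      x ∈ perpPlane u ∧ ∀ᶠ y in nhds x, y ∈ perpPlane u → -y ∈ aggregatedCone P u := by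
  rw [mem_intrinsicInterior_iff_eventually (affineSpan_neg_aggregatedCone hP hne hu hv)]
  have h : ∀ y, y ∈ (ℝ ∙ u)ᗮ ↔ y ∈ perpPlane u := fun y =>
    Submodule.mem_orthogonal_singleton_iff_inner_right
  simp only [h, Set.mem_neg]

/-! ### Sufficiency of the alternative -/

/-- The alternative in the characterization of equiprojectivity. -/
def CoversOrPartitions (P : Set E3) (u : E3) : Prop :=
  aggregatedCone P u = perpPlane u ∨
    (Disjoint (aggregatedCone P u) (intrinsicInterior ℝ (-(aggregatedCone P u))) ∧
      aggregatedCone P u ∪ intrinsicInterior ℝ (-(aggregatedCone P u)) = perpPlane u)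

/-- Under (ii) the covering puts `w × u` or its opposite in `C(u)`. If both were there, genericity
would make `-(w × u)` an edge normal, hence interior to `C(u)`, so `w × u` would be in `C(u)` and in
the relative interior of `-C(u)`. -/
theorem exists_antipodalCount_eq {P : Set E3} (hP : IsPolytope P) (hdim : setDim P = 3) {u : E3}
    (hu : IsEdgeDirection P u) (h : CoversOrPartitions P u) :
    ∃ c, ∀ w, FacetGeneric P w → antipodalCount P u (cross3 w u) = c := by
  have hne := nonempty_of_setDim hdim
  obtain ⟨v₀, hv₀⟩ := ((isEdgeDirection_iff hP hne).1 hu).2.2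
  have hperp : ∀ w, cross3 w u ∈ perpPlane u := fun w => inner_cross3_self w u
  rcases h with h | ⟨hd, hun⟩
  · refine ⟨2, fun w _ => ?_⟩
    rw [antipodalCount, h, if_pos (hperp w), if_pos (neg_mem_perpPlane (hperp w))]
  · refine ⟨1, fun w hw => ?_⟩
    have hint := fun x => mem_intrinsicInterior_neg_iff hP hne hu.ne_zero hv₀ (x := x)
    have hc := hw.cross3_ne_zero hP hdim hu.ne_zero hv₀
    have h1 : cross3 w u ∈ aggregatedCone P u ∨ -cross3 w u ∈ aggregatedCone P u := by
      have := hperp w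
      rw [← hun] at this
      refine this.imp_right fun h => ?_
      exact ((hint _).1 h).2.self_of_nhds (hperp w)
    have h2 : ¬ (cross3 w u ∈ aggregatedCone P u ∧ -cross3 w u ∈ aggregatedCone P u) := by
      rintro ⟨ha, hb⟩
      have hb' := hw.mem_edgeNormals hP hne (neg_ne_zero.2 hc)
        (by rw [inner_neg_left, real_inner_comm, inner_self_cross3, neg_zero]) hu.ne_zero hb
      refine Set.disjoint_left.1 hd ha ((hint _).2 ⟨hperp w, ?_⟩)
      have ht := (continuous_neg (G := E3)).tendsto (cross3 w u)
      filter_upwards [ht.eventually (eventually_mem_aggregatedCone hP hne hu.ne_zero hb')]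
        with y hy hyu using hy (neg_mem_perpPlane hyu)
    rw [antipodalCount]
    split_ifs <;> tauto

theorem isEquiprojective_of_coversOrPartitions {P : Set E3} (hP : IsPolytope P)
    (hdim : setDim P = 3) (h : ∀ u, IsEdgeDirection P u → CoversOrPartitions P u) :
    IsEquiprojective P := by
  have hne := nonempty_of_setDim hdim
  have hED := finite_setOf_isEdgeDirection hP hne
  choose! c hc using fun u (hu : IsEdgeDirection P u) => exists_antipodalCount_eq hP hdim hu (h u hu)
  refine ⟨∑ u ∈ hED.toFinset, c u, fun H hH hgen => ⟨hP.image_starProjection H, ?_, ?_⟩⟩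
  · have h1 := AffineMap.map_vectorSpan (k := ℝ) (s := P)
      (H.starProjection : E3 →ₗ[ℝ] E3).toAffineMap
    have h2 : setDim (H.starProjection '' P) =
        Module.finrank ℝ (vectorSpan ℝ ((H.starProjection : E3 →ₗ[ℝ] E3).toAffineMap '' P)) := rfl
    rw [h2, ← h1, vectorSpan_eq_top hdim, Submodule.map_top]
    have h3 : LinearMap.range ((H.starProjection : E3 →ₗ[ℝ] E3)) = H :=
      Submodule.range_starProjection H
    rw [LinearMap.toAffineMap_linear, h3, hH]
  · have hr : Module.finrank ℝ Hᗮ = 1 := by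
      have := H.finrank_add_finrank_orthogonal
      rw [hH] at this
      simp at this
      omega
    obtain ⟨w', hw'0, hw'⟩ := finrank_eq_one_iff'.1 hr
    have hw0 : (w' : E3) ≠ 0 := fun h => hw'0 (Subtype.ext h)
    set w : E3 := ‖(w' : E3)‖⁻¹ • (w' : E3) with hw
    have hw1 : ‖w‖ = 1 := by
      rw [hw, norm_smul, norm_inv, norm_norm, inv_mul_cancel₀ (norm_ne_zero_iff.2 hw0)]
    have hspan : Hᗮ = ℝ ∙ w := by
      symm
      refine Submodule.eq_of_le_of_finrank_eq ?_ ?_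
      · rw [Submodule.span_singleton_le_iff_mem]
        exact Submodule.smul_mem _ _ w'.2
      · rw [hr, finrank_span_singleton (by rintro h; rw [h] at hw1; simp at hw1)]
    have hHw : H = (ℝ ∙ w)ᗮ := by rw [← hspan, Submodule.orthogonal_orthogonal]
    have hwg : FacetGeneric P w := by
      intro F hF hmem
      refine hgen F hF ?_
      rw [PlaneOrthogonalTo, hspan, Submodule.span_singleton_le_iff_mem]
      exact hmem
    rw [hHw, ncard_extremePoints_projection hP hdim hED hw1 hwg]
    exact Finset.sum_congr rfl fun u hu => hc u (by simpa using hu) w hwg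

/-! ### Antipodal counts along ray germs -/

/-- A ray germ is eventually inside or eventually outside a convex set. -/
theorem Convex.eventually_mem_or_notMem {S : Set E3} (hS : Convex ℝ S) (z d : E3) :
    (∀ᶠ ε in 𝓝[>] (0 : ℝ), z + ε • d ∈ S) ∨ ∀ᶠ ε in 𝓝[>] (0 : ℝ), z + ε • d ∉ S := by
  by_cases h : ∀ᶠ ε in 𝓝[>] (0 : ℝ), z + ε • d ∉ S
  · exact Or.inr h
  left
  have hfr : ∃ᶠ ε in 𝓝[>] (0 : ℝ), z + ε • d ∈ S := fun h' => h h'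
  -- The ray meets `S` at a parameter `b` and, below any `ε < b`, at another one; convexity fills
  -- the interval between them.
  obtain ⟨b, hb, hb0⟩ := (hfr.and_eventually self_mem_nhdsWithin).exists
  filter_upwards [Ioo_mem_nhdsGT hb0] with ε hε
  obtain ⟨a, ha, ha0⟩ := (hfr.and_eventually (Ioo_mem_nhdsGT hε.1)).exists
  have hconv : Convex ℝ ((fun t : ℝ => z + t • d) ⁻¹' S) := by
    intro a ha b hb p q hp hq hpq
    have h1 := hS ha hb hp hq hpq
    obtain rfl : q = 1 - p := by linarith
    rw [Set.mem_preimage]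
    convert h1 using 1
    simp only [smul_eq_mul]
    module
  exact hconv.ordConnected.out ha hb ⟨ha0.2.le, hε.2.le⟩

theorem eventually_mem_or_notMem_aggregatedCone {P : Set E3} (hP : IsPolytope P) (u z d : E3) :
    (∀ᶠ ε in 𝓝[>] (0 : ℝ), z + ε • d ∈ aggregatedCone P u) ∨
      ∀ᶠ ε in 𝓝[>] (0 : ℝ), z + ε • d ∉ aggregatedCone P u := by
  set T := {N | ∃ F, IsFace P F ∧ N = polytopeNormalCone P F ∧ setDim N = 2 ∧ N ⊆ perpPlane u}
  have hT : T.Finite := by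
    refine (hP.finite_setOf_isFace.image (polytopeNormalCone P)).subset ?_
    rintro _ ⟨F, hF, rfl, -⟩
    exact ⟨F, hF, rfl⟩
  have hconv : ∀ N ∈ T, Convex ℝ N := by
    rintro _ ⟨F, -, rfl, -⟩
    exact convex_polytopeNormalCone P F
  by_cases h : ∃ N ∈ T, ∀ᶠ ε in 𝓝[>] (0 : ℝ), z + ε • d ∈ N
  · obtain ⟨N, hN, h⟩ := h
    left
    filter_upwards [h] with ε hε using ⟨N, hN, hε⟩
  · right
    have h1 : ∀ N ∈ T, ∀ᶠ ε in 𝓝[>] (0 : ℝ), z + ε • d ∉ N := fun N hN =>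
      ((hconv N hN).eventually_mem_or_notMem z d).resolve_left fun h' => h ⟨N, hN, h'⟩
    filter_upwards [(eventually_all_finite hT).2 h1] with ε hε
    rintro ⟨N, hN, hmem⟩
    exact hε N hN hmem

theorem exists_eventually_antipodalCount_eq {P : Set E3} (hP : IsPolytope P) (u z d : E3) :
    ∃ c, ∀ᶠ ε in 𝓝[>] (0 : ℝ), antipodalCount P u (z + ε • d) = c := by
  have hneg : ∀ ε : ℝ, -(z + ε • d) = -z + ε • (-d) := fun ε => by module
  rcases eventually_mem_or_notMem_aggregatedCone hP u z d with h1 | h1 <;>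
  rcases eventually_mem_or_notMem_aggregatedCone hP u (-z) (-d) with h2 | h2
  · exact ⟨1 + 1, by
      filter_upwards [h1, h2] with ε h1 h2
      rw [antipodalCount, hneg, if_pos h1, if_pos h2]⟩
  · exact ⟨1 + 0, by
      filter_upwards [h1, h2] with ε h1 h2
      rw [antipodalCount, hneg, if_pos h1, if_neg h2]⟩
  · exact ⟨0 + 1, by
      filter_upwards [h1, h2] with ε h1 h2
      rw [antipodalCount, hneg, if_neg h1, if_pos h2]⟩
  · exact ⟨0 + 0, by
      filter_upwards [h1, h2] with ε h1 h2
      rw [antipodalCount, hneg, if_neg h1, if_neg h2]⟩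

/-- On a ray germ, the antipodal count does not see the component of the direction along the base
point. -/
theorem eventually_antipodalCount_add_smul {P : Set E3} {u z y : E3} {c : ℕ}
    (hc : ∀ᶠ ε in 𝓝[>] (0 : ℝ), antipodalCount P u (z + ε • y) = c) (α : ℝ) {β : ℝ} (hβ : 0 < β) :
    ∀ᶠ ε in 𝓝[>] (0 : ℝ), antipodalCount P u (z + ε • (α • z + β • y)) = c := by
  have h1 : Tendsto (fun ε : ℝ => 1 + ε * α) (𝓝[>] 0) (𝓝 1) := by
    have : Continuous fun ε : ℝ => 1 + ε * α := by fun_prop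
    simpa using (this.tendsto 0).mono_left nhdsWithin_le_nhds
  have hpos : ∀ᶠ ε in 𝓝[>] (0 : ℝ), 0 < 1 + ε * α := h1.eventually_const_lt one_pos
  -- Factoring out `1 + εα > 0`, which the count ignores, leaves the original ray at parameter `εβ /
  -- (1 + εα)`, which tends to 0 from the right.
  have h2 : Tendsto (fun ε : ℝ => ε * β / (1 + ε * α)) (𝓝[>] 0) (𝓝[>] 0) := by
    refine tendsto_nhdsWithin_iff.2 ⟨?_, ?_⟩
    · have h3 : Tendsto (fun ε : ℝ => ε * β) (𝓝[>] 0) (𝓝 0) := by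
        have : Continuous fun ε : ℝ => ε * β := by fun_prop
        simpa using (this.tendsto 0).mono_left nhdsWithin_le_nhds
      have h5 := h3.div h1 one_ne_zero
      rw [zero_div] at h5
      exact h5
    · filter_upwards [hpos, self_mem_nhdsWithin] with ε h3 (h4 : 0 < ε)
      exact div_pos (mul_pos h4 hβ) h3
  filter_upwards [hpos, h2.eventually hc] with ε h3 h4
  have h5 : (1 + ε * α) • (z + (ε * β / (1 + ε * α)) • y) = z + ε • (α • z + β • y) := by
    rw [smul_add, smul_smul, mul_div_cancel₀ _ h3.ne']
    module
  rw [← h4, ← h5, antipodalCount_smul_of_pos _ _ _ h3]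

/-- Put `z = u₀ × u` and `y = u × z`. Perturbing `u₀` by `±εm` moves `z` inside `u^⊥` to the two
sides `±y`, and only the side affects the count for small `ε`. The sign of `⟪z, m⟫` merely decides
which perturbation goes to which side, so the sum of the two limiting counts is independent of `m`.
-/
theorem exists_sum_antipodalCount_eq {P : Set E3} (hP : IsPolytope P) {u u₀ : E3} (hu : u ≠ 0)
    (hz : cross3 u₀ u ≠ 0) :
    ∃ K, ∀ m, inner ℝ (cross3 u₀ u) m ≠ 0 → ∀ᶠ ε in 𝓝[>] (0 : ℝ),
      antipodalCount P u (cross3 (u₀ + ε • m) u) + antipodalCount P u (cross3 (u₀ - ε • m) u) =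
        K := by
  set z := cross3 u₀ u with hzdef
  set y := cross3 u z with hy
  obtain ⟨c₁, hc₁⟩ := exists_eventually_antipodalCount_eq hP u z y
  obtain ⟨c₂, hc₂⟩ := exists_eventually_antipodalCount_eq hP u z (-y)
  refine ⟨c₁ + c₂, fun m hm => ?_⟩
  have huz : inner ℝ u z = 0 := inner_cross3_self u₀ u
  have huu : inner ℝ u u ≠ (0 : ℝ) := inner_self_ne_zero.2 hu
  have hzz : inner ℝ z z ≠ (0 : ℝ) := inner_self_ne_zero.2 hz
  have h0 : inner ℝ u u * inner ℝ z z ≠ (0 : ℝ) := mul_ne_zero huu hzz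
  have hd := smul_eq_of_orthogonal (u := u) (a := z) (b := cross3 m u) huz (inner_cross3_self m u)
  have hβ' : inner ℝ y (cross3 m u) ≠ 0 := by
    rw [hy, inner_cross3_comm, cross3_cross3, inner_sub_right, real_inner_smul_right,
      real_inner_smul_right, real_inner_comm u z, huz, zero_mul, zero_sub, neg_ne_zero]
    exact mul_ne_zero hm huu
  obtain ⟨α, β, hβ, hαβ⟩ : ∃ α β : ℝ, β ≠ 0 ∧ cross3 m u = α • z + β • y := by
    refine ⟨(inner ℝ u u * inner ℝ z z)⁻¹ * (inner ℝ u u * inner ℝ z (cross3 m u)),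
      (inner ℝ u u * inner ℝ z z)⁻¹ * inner ℝ y (cross3 m u),
      mul_ne_zero (inv_ne_zero h0) hβ', ?_⟩
    rw [← hy] at hd
    calc cross3 m u = (inner ℝ u u * inner ℝ z z)⁻¹ •
          ((inner ℝ u u * inner ℝ z z) • cross3 m u) := (inv_smul_smul₀ h0 _).symm
      _ = _ := by rw [hd, smul_add, smul_smul, smul_smul]
  have hplus : ∀ ε : ℝ, cross3 (u₀ + ε • m) u = z + ε • (α • z + β • y) := fun ε => by
    rw [cross3_add_left, cross3_smul_left, hαβ]
  have hminus : ∀ ε : ℝ, cross3 (u₀ - ε • m) u = z + ε • ((-α) • z + (-β) • y) := fun ε => by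
    rw [cross3_sub_left, cross3_smul_left, hαβ]
    module
  rcases lt_or_gt_of_ne hβ with h | h
  · filter_upwards [eventually_antipodalCount_add_smul hc₁ (-α) (neg_pos.2 h),
      eventually_antipodalCount_add_smul hc₂ α (neg_pos.2 h)] with ε h1 h2
    rw [hplus, hminus, h1, add_comm]
    rw [neg_smul_neg] at h2
    rw [h2]
  · filter_upwards [eventually_antipodalCount_add_smul hc₁ α h,
      eventually_antipodalCount_add_smul hc₂ (-α) h] with ε h1 h2
    rw [hplus, hminus, h1]
    rw [smul_neg, ← neg_smul] at h2
    rw [h2]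

/-! ### Perturbing an edge direction, and necessity of the alternative -/

/-- In a subspace, the vectors outside finitely many subspaces that do not contain it are dense. -/
theorem frequently_notMem_of_finite {B : Submodule ℝ E3} {T : Set (Submodule ℝ E3)}
    (hT : T.Finite) (h : ∀ W ∈ T, ¬ B ≤ W) {x : E3} (hx : x ∈ B) :
    ∃ᶠ m in 𝓝 x, m ∈ B ∧ ∀ W ∈ T, m ∉ W := by
  classical
  obtain ⟨d, hdB, hd⟩ : ∃ d ∈ B, ∀ W ∈ T, d ∉ W := by
    -- A vector space over an infinite field is not a finite union of proper subspaces. The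
    -- resulting `d` then serves as a direction for leaving every `W` that contains `x`.
    have h1 : (⊤ : Submodule ℝ B) ∉ hT.toFinset.image (fun W => W.comap B.subtype) := by
      intro hmem
      obtain ⟨W, hW, hWt⟩ := Finset.mem_image.1 hmem
      refine h W (by simpa using hW) fun b hb => ?_
      have : (⟨b, hb⟩ : B) ∈ W.comap B.subtype := hWt ▸ trivial
      exact this
    have h2 := Subspace.biUnion_ne_univ_of_top_notMem h1
    obtain ⟨d, hd⟩ := (Set.ne_univ_iff_exists_notMem _).1 h2
    refine ⟨d, d.2, fun W hW hdW => hd ?_⟩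
    refine Set.mem_biUnion (x := W.comap B.subtype) ?_ hdW
    exact Finset.mem_image.2 ⟨W, by simpa using hW, rfl⟩
  have ht : Tendsto (fun ε : ℝ => x + ε • d) (𝓝[>] 0) (𝓝 x) := by
    have : Continuous fun ε : ℝ => x + ε • d := by fun_prop
    simpa using (this.tendsto 0).mono_left nhdsWithin_le_nhds
  refine ht.frequently (Eventually.frequently ?_)
  have h3 : ∀ W ∈ T, ∀ᶠ ε in 𝓝[>] (0 : ℝ), x + ε • d ∉ W := by
    intro W hW
    by_cases hxW : x ∈ W
    · filter_upwards [self_mem_nhdsWithin] with ε (hε : 0 < ε) hmem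
      rw [W.add_mem_iff_right hxW, W.smul_mem_iff hε.ne'] at hmem
      exact hd W hW hmem
    · exact ht.eventually ((W.closed_of_finiteDimensional.isOpen_compl).mem_nhds hxW)
  filter_upwards [(eventually_all_finite hT).2 h3] with ε hε
  exact ⟨B.add_mem hx (B.smul_mem ε hdB), hε⟩

/-- The subspaces to be avoided when perturbing the direction `u₀`: the planes of the facets
parallel to `u₀`, and the planes spanned by `u₀` and another edge direction. -/
def criticalSubspaces (P : Set E3) (u₀ : E3) : Set (Submodule ℝ E3) :=
  {W | (∃ F, IsFacet P F ∧ W = vectorSpan ℝ F ∧ u₀ ∈ W) ∨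
    ∃ u, IsEdgeDirection P u ∧ u ≠ u₀ ∧ W = (ℝ ∙ cross3 u₀ u)ᗮ}

theorem finite_criticalSubspaces {P : Set E3} (hP : IsPolytope P) (hne : P.Nonempty) (u₀ : E3) :
    (criticalSubspaces P u₀).Finite := by
  refine ((hP.finite_setOf_isFace.image (fun F => vectorSpan ℝ F)).union
    ((finite_setOf_isEdgeDirection hP hne).image (fun u => (ℝ ∙ cross3 u₀ u)ᗮ))).subset ?_
  rintro W (⟨F, hF, rfl, -⟩ | ⟨u, hu, -, rfl⟩)
  · exact Or.inl ⟨F, hF.1, rfl⟩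
  · exact Or.inr ⟨u, hu, rfl⟩

theorem IsEdgeDirection.cross3_ne_zero {P : Set E3} {u u₀ : E3} (hu₀ : IsEdgeDirection P u₀)
    (hu : IsEdgeDirection P u) (h : u ≠ u₀) : cross3 u₀ u ≠ 0 := by
  intro h0
  obtain ⟨c, hc⟩ := exists_smul_of_cross3_eq_zero hu₀.ne_zero h0
  exact h (hu₀.eq_of_smul hu hc)

/-- A critical facet plane already contains `u₀`, so containing `u₀^⊥` would make it the whole
space. In the other case `u₀ × u` is in `u₀^⊥` but not orthogonal to itself. -/
theorem not_le_of_mem_criticalSubspaces {P : Set E3} {u₀ : E3} (hu₀ : IsEdgeDirection P u₀)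
    {W : Submodule ℝ E3} (hW : W ∈ criticalSubspaces P u₀) : ¬ (ℝ ∙ u₀)ᗮ ≤ W := by
  rintro hle
  rcases hW with ⟨F, hF, rfl, hmem⟩ | ⟨u, hu, hne, rfl⟩
  · have h1 : (⊤ : Submodule ℝ E3) ≤ vectorSpan ℝ F := by
      rw [← Submodule.sup_orthogonal_of_hasOrthogonalProjection (K := ℝ ∙ u₀)]
      exact sup_le ((Submodule.span_singleton_le_iff_mem _ _).2 hmem) hle
    have h2 : Module.finrank ℝ (vectorSpan ℝ F) = 2 := hF.2
    rw [top_le_iff.1 h1] at h2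
    simp at h2
  · have h1 : cross3 u₀ u ∈ (ℝ ∙ cross3 u₀ u)ᗮ :=
      hle (Submodule.mem_orthogonal_singleton_iff_inner_right.2 (inner_self_cross3 u₀ u))
    rw [Submodule.mem_orthogonal_singleton_iff_inner_right, inner_self_eq_zero] at h1
    exact hu₀.cross3_ne_zero hu hne h1

/-- Facet planes through `u₀` are left at once because `m` avoids them; the others are closed and
miss a neighbourhood of `u₀`. -/
theorem eventually_facetGeneric {P : Set E3} (hP : IsPolytope P) {u₀ m : E3}
    (hm : ∀ W ∈ criticalSubspaces P u₀, m ∉ W) :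
    ∀ᶠ ε in 𝓝[>] (0 : ℝ), FacetGeneric P (u₀ + ε • m) := by
  have ht : Tendsto (fun ε : ℝ => u₀ + ε • m) (𝓝[>] 0) (𝓝 u₀) := by
    have : Continuous fun ε : ℝ => u₀ + ε • m := by fun_prop
    simpa using (this.tendsto 0).mono_left nhdsWithin_le_nhds
  have hfin : {F | IsFacet P F}.Finite := hP.finite_setOf_isFace.subset fun F hF => hF.1
  refine (eventually_all_finite hfin).2 fun F hF => ?_
  by_cases hu : u₀ ∈ vectorSpan ℝ F
  · filter_upwards [self_mem_nhdsWithin] with ε (hε : 0 < ε) hmem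
    rw [(vectorSpan ℝ F).add_mem_iff_right hu, (vectorSpan ℝ F).smul_mem_iff hε.ne'] at hmem
    exact hm _ (Or.inl ⟨F, hF, rfl, hu⟩) hmem
  · exact ht.eventually
      (((vectorSpan ℝ F).closed_of_finiteDimensional.isOpen_compl).mem_nhds hu)

theorem IsKEquiprojective.sum_antipodalCount {P : Set E3} (hP : IsPolytope P) (hdim : setDim P = 3)
    {k : ℕ} (hk : IsKEquiprojective k P) (hED : {u | IsEdgeDirection P u}.Finite) {w : E3}
    (hw0 : w ≠ 0) (hw : FacetGeneric P w) :
    ∑ u ∈ hED.toFinset, antipodalCount P u (cross3 w u) = k := by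
  have hn := inv_ne_zero (norm_ne_zero_iff.2 hw0)
  have hw' := hw.smul hn
  set w' := ‖w‖⁻¹ • w with hw'def
  have hw1 : ‖w'‖ = 1 := by
    rw [hw'def, norm_smul, norm_inv, norm_norm, inv_mul_cancel₀ (norm_ne_zero_iff.2 hw0)]
  have h1 := ncard_extremePoints_projection hP hdim hED hw1 hw'
  have h2 := hk (ℝ ∙ w')ᗮ (finrank_orthogonal_span (smul_ne_zero hn hw0))
    fun F hF hort => hw' F hF (hort (by
      rw [Submodule.orthogonal_orthogonal]
      exact Submodule.mem_span_singleton_self w'))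
  rw [← h2.2.2, h1]
  refine Finset.sum_congr rfl fun u _ => ?_
  rw [hw'def, cross3_smul_left, antipodalCount_smul _ _ _ hn]

theorem IsKEquiprojective.exists_antipodalCount_eq {P : Set E3} (hP : IsPolytope P)
    (hdim : setDim P = 3) {k : ℕ} (hk : IsKEquiprojective k P) {u₀ : E3}
    (hu₀ : IsEdgeDirection P u₀) :
    ∃ c, ∀ m, (∀ W ∈ criticalSubspaces P u₀, m ∉ W) → antipodalCount P u₀ (cross3 m u₀) = c := by
  classical
  have hne := nonempty_of_setDim hdim
  have hED := finite_setOf_isEdgeDirection hP hne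
  choose! K hK using fun u (hu : IsEdgeDirection P u ∧ u ≠ u₀) =>
    exists_sum_antipodalCount_eq hP hu.1.ne_zero (hu₀.cross3_ne_zero hu.1 hu.2)
  -- Adding the vertex counts for `u₀ + εm` and `u₀ - εm` gives `2k = 2c + ∑ K u`, so neither the
  -- natural subtraction nor the division truncates.
  refine ⟨(2 * k - ∑ u ∈ hED.toFinset.erase u₀, K u) / 2, fun m hm => ?_⟩
  have hm' : ∀ W ∈ criticalSubspaces P u₀, -m ∉ W := fun W hW h =>
    hm W hW (by simpa using W.neg_mem h)
  have h1 : ∀ᶠ ε in 𝓝[>] (0 : ℝ), ∀ u ∈ hED.toFinset.erase u₀,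
      antipodalCount P u (cross3 (u₀ + ε • m) u) + antipodalCount P u (cross3 (u₀ - ε • m) u) =
        K u := by
    refine (Filter.eventually_all_finset _).2 fun u hu => ?_
    have hu' : IsEdgeDirection P u ∧ u ≠ u₀ := by
      simpa [and_comm] using hu
    refine hK u hu' m fun h => ?_
    exact hm _ (Or.inr ⟨u, hu'.1, hu'.2, rfl⟩)
      (Submodule.mem_orthogonal_singleton_iff_inner_right.2 h)
  obtain ⟨v, hv⟩ := ((isEdgeDirection_iff hP hne).1 hu₀).2.2
  obtain ⟨ε, ⟨⟨⟨h1, h2⟩, h3⟩, hε : 0 < ε⟩⟩ := (((h1.and (eventually_facetGeneric hP hm)).and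
    (eventually_facetGeneric hP hm')).and self_mem_nhdsWithin).exists
  rw [smul_neg, ← sub_eq_add_neg] at h3
  have hw0 : ∀ w, FacetGeneric P w → w ≠ 0 := by
    rintro w hw rfl
    refine hw.cross3_ne_zero hP hdim hu₀.ne_zero hv ?_
    apply ext_coords <;> simp
  have s1 := hk.sum_antipodalCount hP hdim hED (hw0 _ h2) h2
  have s2 := hk.sum_antipodalCount hP hdim hED (hw0 _ h3) h3
  have hmem : u₀ ∈ hED.toFinset := by simpa using hu₀
  have e1 : antipodalCount P u₀ (cross3 (u₀ + ε • m) u₀) = antipodalCount P u₀ (cross3 m u₀) := by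
    rw [cross3_add_left, cross3_self, zero_add, cross3_smul_left, antipodalCount_smul _ _ _ hε.ne']
  have e2 : antipodalCount P u₀ (cross3 (u₀ - ε • m) u₀) = antipodalCount P u₀ (cross3 m u₀) := by
    rw [cross3_sub_left, cross3_self, zero_sub, cross3_smul_left, antipodalCount_neg,
      antipodalCount_smul _ _ _ hε.ne']
  rw [← Finset.add_sum_erase _ _ hmem, e1] at s1
  rw [← Finset.add_sum_erase _ _ hmem, e2] at s2
  have s3 : ∑ u ∈ hED.toFinset.erase u₀, antipodalCount P u (cross3 (u₀ + ε • m) u) +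
      ∑ u ∈ hED.toFinset.erase u₀, antipodalCount P u (cross3 (u₀ - ε • m) u) =
      ∑ u ∈ hED.toFinset.erase u₀, K u := by
    rw [← Finset.sum_add_distrib]
    exact Finset.sum_congr rfl h1
  omega

/-- The map `m ↦ m × u₀` is continuous and sends `u₀ × x` to `x`, so it carries the noncritical
vectors of `u₀^⊥` near `u₀ × x` to vectors arbitrarily close to `x`. -/
theorem frequently_antipodalCount_eq {P : Set E3} (hP : IsPolytope P) (hne : P.Nonempty)
    {u₀ : E3} (hu₀ : IsEdgeDirection P u₀) {c : ℕ}
    (hc : ∀ m, (∀ W ∈ criticalSubspaces P u₀, m ∉ W) → antipodalCount P u₀ (cross3 m u₀) = c)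
    {x : E3} (hx : x ∈ perpPlane u₀) :
    ∃ᶠ v in 𝓝 x, v ∈ perpPlane u₀ ∧ antipodalCount P u₀ v = c := by
  have h1 := frequently_notMem_of_finite (finite_criticalSubspaces hP hne u₀)
    (fun W hW => not_le_of_mem_criticalSubspaces hu₀ hW) (x := cross3 u₀ x)
    (Submodule.mem_orthogonal_singleton_iff_inner_right.2 (inner_self_cross3 u₀ x))
  have hx' : cross3 (cross3 u₀ x) u₀ = x := by
    rw [cross3_anticomm, cross3_cross3, mem_perpPlane.1 hx, real_inner_self_eq_norm_sq, hu₀.1]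
    module
  have hcont : Continuous fun m => cross3 m u₀ := by
    let L : E3 →ₗ[ℝ] E3 :=
      { toFun := fun m => cross3 m u₀
        map_add' := fun a b => cross3_add_left a b u₀
        map_smul' := fun r a => cross3_smul_left r a u₀ }
    exact L.continuous_of_finiteDimensional
  have ht : Tendsto (fun m => cross3 m u₀) (𝓝 (cross3 u₀ x)) (𝓝 x) := by
    simpa only [hx'] using hcont.tendsto (cross3 u₀ x)
  exact ht.frequently (h1.mono fun m hm => ⟨inner_cross3_self m u₀, hc m hm.2⟩)

/-- This moves a possibly boundary vector `x` of a normal cone to a vector, as close as desired,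
that exposes exactly the face defining the cone. -/
theorem supportFace_add_smul {P : Set E3} (hc : IsCompact P) (hne : P.Nonempty) {x v : E3}
    (h : supportFace P v ⊆ supportFace P x) {t : ℝ} (ht : 0 < t) :
    supportFace P (x + t • v) = supportFace P v := by
  obtain ⟨p, hp⟩ := supportFace_nonempty hc hne v
  have hp' := h hp
  ext y
  constructor
  · intro hy
    refine mem_supportFace_of_inner_eq hp hy.1 (le_antisymm ?_ (hp.2 y hy.1))
    have h1 := hy.2 p hp.1
    have h2 := hp'.2 y hy.1
    rw [inner_add_left, inner_add_left, real_inner_smul_left, real_inner_smul_left] at h1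
    have h3 : t * inner ℝ v p ≤ t * inner ℝ v y := by linarith
    exact le_of_mul_le_mul_left h3 ht
  · intro hy
    refine ⟨hy.1, fun z hz => ?_⟩
    rw [inner_add_left, inner_add_left, real_inner_smul_left, real_inner_smul_left]
    have h1 := hy.2 z hz
    have h2 := (h hy).2 z hz
    gcongr

theorem coversOrPartitions_of_isKEquiprojective {P : Set E3} (hP : IsPolytope P)
    (hdim : setDim P = 3) {k : ℕ} (hk : IsKEquiprojective k P) {u : E3}
    (hu : IsEdgeDirection P u) : CoversOrPartitions P u := by
  have hne := nonempty_of_setDim hdim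
  obtain ⟨c, hc⟩ := hk.exists_antipodalCount_eq hP hdim hu
  have hfreq := fun x hx => frequently_antipodalCount_eq hP hne hu hc (x := x) hx
  obtain ⟨v₀, hv₀⟩ := ((isEdgeDirection_iff hP hne).1 hu).2.2
  have hint := fun x => mem_intrinsicInterior_neg_iff hP hne hu.ne_zero hv₀ (x := x)
  have hclosed := isClosed_aggregatedCone hP u
  -- Near `v₀` the whole plane `u^⊥` lies in `C(u)`, which forces a count of at least 1.
  have hc12 : c = 1 ∨ c = 2 := by
    obtain ⟨v, ⟨hv, hvc⟩, hvC⟩ := ((hfreq v₀ (inner_eq_zero_of_mem_edgeNormals hv₀)).and_eventually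
      (eventually_mem_aggregatedCone hP hne hu.ne_zero hv₀)).exists
    rw [antipodalCount, if_pos (hvC hv)] at hvc
    split_ifs at hvc <;> omega
  rcases hc12 with rfl | rfl
  · right
    constructor
    · rw [Set.disjoint_left]
      intro x hx hx'
      obtain ⟨hxu, hx'⟩ := (hint x).1 hx'
      obtain ⟨v, hv, hxv⟩ := (mem_aggregatedCone_iff hP hne hu.ne_zero).1 hx
      rw [mem_polytopeNormalCone_supportFace] at hxv
      -- For small `t > 0` the vector `x + t • v` is an edge normal, hence interior to `C(u)`, and
      -- is still interior to `-C(u)`. Nearby generic vectors would then have count 2.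
      have ht : Tendsto (fun t : ℝ => x + t • v) (𝓝[>] 0) (𝓝 x) := by
        have : Continuous fun t : ℝ => x + t • v := by fun_prop
        simpa using (this.tendsto 0).mono_left nhdsWithin_le_nhds
      obtain ⟨t, h1, h2 : 0 < t⟩ := ((ht.eventually (eventually_eventually_nhds.2 hx')).and
        self_mem_nhdsWithin).exists
      have h3 : x + t • v ∈ edgeNormals P u := by
        have : vectorSpan ℝ (supportFace P v) = ℝ ∙ u := hv
        rwa [← supportFace_add_smul hP.isCompact hne hxv h2] at this
      obtain ⟨y, ⟨hy, hyc⟩, hy1, hy2⟩ :=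
        ((hfreq _ (inner_eq_zero_of_mem_edgeNormals h3)).and_eventually
          (h1.and (eventually_mem_aggregatedCone hP hne hu.ne_zero h3))).exists
      rw [antipodalCount, if_pos (hy1 hy), if_pos (hy2 hy)] at hyc
      omega
    · refine subset_antisymm ?_ fun x hx => ?_
      · exact Set.union_subset (aggregatedCone_subset P u) fun x hx => ((hint x).1 hx).1
      · refine or_iff_not_imp_left.2 fun hxC => (hint x).2 ⟨hx, ?_⟩
        -- Near `x`, outside the closed cone, the dense set of vectors with count 1 lies in `-C(u)`;
        -- closedness extends this to every nearby vector of `u^⊥`.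
        have h1 : ∀ᶠ y in 𝓝 x, y ∉ aggregatedCone P u := hclosed.isOpen_compl.mem_nhds hxC
        filter_upwards [eventually_eventually_nhds.2 h1] with y hy hyu
        have h2 : ∃ᶠ z in 𝓝 y, z ∈ -aggregatedCone P u := by
          refine ((hfreq y hyu).and_eventually hy).mono fun z hz => ?_
          obtain ⟨⟨-, hzc⟩, hzC⟩ := hz
          rw [antipodalCount, if_neg hzC] at hzc
          by_contra hneg
          rw [if_neg (Set.mem_neg.not.1 hneg)] at hzc
          omega
        exact (hclosed.neg).mem_of_frequently_of_tendsto h2 tendsto_id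
  · left
    refine subset_antisymm (aggregatedCone_subset P u) fun x hx => ?_
    -- Count 2 on a dense set means that the closed cone contains a dense subset of the plane.
    refine hclosed.mem_of_frequently_of_tendsto ((hfreq x hx).mono fun z hz => ?_) tendsto_id
    obtain ⟨-, hzc⟩ := hz
    rw [antipodalCount] at hzc
    by_contra hzC
    rw [id] at hzC
    rw [if_neg hzC] at hzc
    split_ifs at hzc <;> omega

theorem theorem2 (P : Set E3) (hP : IsPolytope P) (hdim : setDim P = 3) :
    IsEquiprojective P ↔
      ∀ u : E3, IsEdgeDirection P u →
        (aggregatedCone P u = perpPlane u ∨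
          (Disjoint (aggregatedCone P u) (intrinsicInterior ℝ (-(aggregatedCone P u))) ∧
            aggregatedCone P u ∪ intrinsicInterior ℝ (-(aggregatedCone P u)) = perpPlane u)) :=
  ⟨fun ⟨_, hk⟩ _ hu => coversOrPartitions_of_isKEquiprojective hP hdim hk hu,
    isEquiprojective_of_coversOrPartitions hP hdim⟩
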